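/- A family $\mathcal A$ of infinite subsets of $\omega$ is almost disjoint if it is infinite and any two distinct members of $\mathcal A$ have finite intersection. It is of true cardinality $\mathfrak c$ if for every $B\subseteq\omega$ the family $\{a\in\mathcal A : a\cap B \text{ is infinite}\}$ is either finite or of cardinality $\mathfrak c=2^{\aleph_0}$. The space $\Psi(\mathcal A)$ has underlying set the disjoint union $\omega\cup\mathcal A$; each point of $\omega$ is isolated, and the sets $\{a\}\cup(a\setminus F)$ with $F\subset\omega$ finite form a neighbourhood base at $a\in\mathcal A$. A subset $A$ of a topological space is regularly closed if $A=\overline{\operatorname{int}(A)}$. For a positive integer $n$, a space is $n$-partly-normal if it is regular (including $T_1$) and any two disjoint subsets $A$ and $B$, where $A$ is regularly closed and $B$ is an intersection of at most $n$ regularly closed sets, can be separated, i.e. there are disjoint open sets $U\supseteq A$ and $V\supseteq B$. **Theorem.** For every positive integer $n$ there exists an almost disjoint family $\mathcal A$ of true cardinality $\mathfrak c$ such that $\Psi(\mathcal A)$ is $n$-partly-normal but not $(n+1)$-partly-normal. -/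

import Mathlib

/-- `A` is regularly closed: it is the closure of its interior. -/
def IsRegularClosed {X : Type*} [TopologicalSpace X] (A : Set X) : Prop :=
  A = closure (interior A)

/-- `B` is the intersection of at most `n` regularly closed sets. (The empty intersection is the
whole space, which is itself regularly closed, so admitting it changes nothing for `1 ≤ n`.) -/
def IsInterOfAtMostRegularClosed {X : Type*} [TopologicalSpace X] (n : ℕ) (B : Set X) : Prop :=
  ∃ K : Finset (Set X), K.card ≤ n ∧ (∀ C ∈ K, IsRegularClosed C) ∧ B = ⋂ C ∈ K, C

/-- `n`-partly-normal spaces. As in Engelking's book, "regular" includes the `T₁` axiom. -/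
structure IsPartlyNormal (n : ℕ) (X : Type*) [TopologicalSpace X] : Prop where
  regular : T3Space X
  separated : ∀ A B : Set X, IsRegularClosed A → IsInterOfAtMostRegularClosed n B →
    Disjoint A B → SeparatedNhds A B

/-- Infinite almost disjoint families of infinite subsets of `ω`. -/
structure IsAlmostDisjointFamily (𝒜 : Set (Set ℕ)) : Prop where
  infinite : 𝒜.Infinite
  infinite_of_mem : ∀ a ∈ 𝒜, a.Infinite
  finite_inter : ∀ a ∈ 𝒜, ∀ b ∈ 𝒜, a ≠ b → (a ∩ b).Finite

/-- The members of `𝒜` which meet `B` in an infinite set. -/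
def familyRestrict (𝒜 : Set (Set ℕ)) (B : Set ℕ) : Set (Set ℕ) :=
  {a ∈ 𝒜 | (a ∩ B).Infinite}

/-- For every `B ⊆ ω`, only finitely many or exactly `𝔠` many members of `𝒜` meet `B` in an
infinite set. -/
def HasTrueCardinalityContinuum (𝒜 : Set (Set ℕ)) : Prop :=
  ∀ B : Set ℕ, (familyRestrict 𝒜 B).Finite ∨
    Cardinal.mk (familyRestrict 𝒜 B) = Cardinal.continuum

/-- The underlying set `ω ∪ 𝒜` (a disjoint union) of the Mrówka–Isbell space of `𝒜`. -/
inductive PsiSpace (𝒜 : Set (Set ℕ)) : Type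
  | nat (k : ℕ) : PsiSpace 𝒜
  | mem (a : 𝒜) : PsiSpace 𝒜

/-- The topology of the Mrówka–Isbell space: every point of `ω` is isolated, and the sets
`{a} ∪ (a \ F)` with `F ⊆ ω` finite are a neighbourhood base at `a ∈ 𝒜`. -/
instance PsiSpace.instTopologicalSpace (𝒜 : Set (Set ℕ)) : TopologicalSpace (PsiSpace 𝒜) where
  IsOpen U := ∀ a : 𝒜, PsiSpace.mem a ∈ U →
    ∃ F : Set ℕ, F.Finite ∧ ∀ k ∈ (a : Set ℕ) \ F, PsiSpace.nat k ∈ U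
  isOpen_univ := fun _ _ => ⟨∅, Set.finite_empty, fun _ _ => Set.mem_univ _⟩
  isOpen_inter := by
    intro U V hU hV a ha
    obtain ⟨F, hF, hFU⟩ := hU a ha.1
    obtain ⟨G, hG, hGV⟩ := hV a ha.2
    exact ⟨F ∪ G, hF.union hG, fun k hk =>
      ⟨hFU k ⟨hk.1, fun h => hk.2 (Or.inl h)⟩, hGV k ⟨hk.1, fun h => hk.2 (Or.inr h)⟩⟩⟩
  isOpen_sUnion := by
    intro S hS a ha
    obtain ⟨U, hU, haU⟩ := ha
    obtain ⟨F, hF, hFU⟩ := hS U hU a haU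
    exact ⟨F, hF, fun k hk => ⟨U, hU, hFU k hk⟩⟩

open Filter Set

/-! For an almost disjoint family ℳ, a point a ∈ ℳ lies in a regularly closed set exactly when a
meets the trace of that set on ω infinitely often, and disjoint closed sets can be separated as soon
as one of them contains only finitely many points of ℳ. So Ψ(ℳ) is n-partly-normal once ℳ is rich
for n + 1 sets: whenever each of at most n + 1 sets is met infinitely by infinitely many members, a
single member meets them all infinitely. If moreover every member almost misses one of n + 2
disjoint colour classes, then the closure of one class is disjoint from the intersection of the
closures of the others, while richness rules out a separation (`not_isPartlyNormal`).

Such an ℳ comes from a family 𝒜 of true cardinality 𝔠 whose members each meet at most one colour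
class infinitely. Its members are merged, by a recursion of length 𝔠, into disjoint blocks of at
most n + 1; the block unions are rich, and by counting each almost misses one of n + 2 colours
(`exists_blocks`, `exists_rich_family`).

The main work is to find 𝒜 in ZFC (`exists_coloured_family`). A tree of countably generated filters
on ω is grown, and infinite sets are attached to some of its nodes, each converging to its node.
Filters below a child of a node contain the complement of the set attached there, and incomparable
nodes are disjoint, so the attached sets are almost disjoint. Two facts drive the recursion. A set
meeting infinitely many attached sets infinitely is positive for some node
(`IsSystem.exists_positive_node`). A set positive for some node is positive for an unused one while
fewer than 𝔠 sets are attached, since otherwise a Cantor tree of nodes would use 𝔠 of them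
(`IsSystem.exists_unused_node`). Treating every subset of ω at 𝔠 many stages then gives true
cardinality 𝔠. The children needed for both facts are cut out of a grid by a scale in ω^ω
(`exists_isChildFamily`). -/

/-- Well-founded recursion with a choice at every step. -/
theorem exists_recursive_choice {J : Type*} [LT J] [WellFoundedLT J] {α : Type*}
    (P : (i : J) → ((j : J) → j < i → α) → α → Prop) (H : ∀ i g, ∃ x, P i g x) :
    ∃ f : J → α, ∀ i, P i (fun j _ => f j) (f i) := by
  choose G hG using H
  refine ⟨(wellFounded_lt (α := J)).fix G, fun i => ?_⟩
  rw [WellFounded.fix_eq]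
  exact hG _ _

/-! ### Scales and a well-order of type 𝔠 -/

/-- An increasing unbounded sequence, indexed by a well-order, of monotone functions `ℕ → ℕ`. -/
structure IsScale {I : Type} [LinearOrder I] (h : I → ℕ → ℕ) : Prop where
  mono : ∀ i, Monotone (h i)
  increasing : ∀ i j, i < j → ∀ᶠ n in atTop, h i n ≤ h j n
  unbounded : ∀ w : ℕ → ℕ, ∃ i, ∃ᶠ n in atTop, w n < h i n
  countably_bounded : ∀ s : ℕ → I, ∃ i, ∀ k, s k < i

theorem exists_monotone_eventually_gt (s : ℕ → ℕ → ℕ) :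
    ∃ g : ℕ → ℕ, Monotone g ∧ ∀ k, ∀ᶠ n in atTop, s k n < g n := by
  -- The outer sum forces monotonicity; its last summand already exceeds `s k n` for all k ≤ n.
  refine ⟨fun n => ∑ m ∈ Finset.range (n + 1), ∑ k ∈ Finset.range (m + 1), (s k m + 1), ?_, ?_⟩
  · intro a b hab
    exact Finset.sum_le_sum_of_subset (Finset.range_mono (by omega))
  · intro k
    filter_upwards [eventually_ge_atTop k] with n hn
    calc s k n < s k n + 1 := Nat.lt_succ_self _
      _ ≤ ∑ k ∈ Finset.range (n + 1), (s k n + 1) :=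
        Finset.single_le_sum (f := fun k => s k n + 1) (fun _ _ => Nat.zero_le _)
          (Finset.mem_range.2 (by omega))
      _ ≤ _ := Finset.single_le_sum (f := fun m => ∑ k ∈ Finset.range (m + 1), (s k m + 1))
          (fun _ _ => Nat.zero_le _) (Finset.mem_range.2 (Nat.lt_succ_self n))

theorem exists_scale : ∃ (I : Type) (_ : LinearOrder I) (_ : WellFoundedLT I) (h : I → ℕ → ℕ),
    IsScale h := by
  classical
  -- Longer than the number of functions, so the recursion of strict eventual bounds has to get
  -- stuck.
  let J : Type := (Order.succ (Cardinal.mk (ℕ → ℕ))).ord.ToType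
  let Bd : Set (ℕ → ℕ) → (ℕ → ℕ) → Prop :=
    fun S g => Monotone g ∧ ∀ f ∈ S, ∀ᶠ n in atTop, f n < g n
  obtain ⟨f, hf⟩ := exists_recursive_choice (J := J) (α := ℕ → ℕ)
    (fun i g x => (∃ y, Bd {z | ∃ j, ∃ hj : j < i, g j hj = z} y) →
      Bd {z | ∃ j, ∃ hj : j < i, g j hj = z} x) (by
      intro i g
      by_cases hy : ∃ y, Bd {z | ∃ j, ∃ hj : j < i, g j hj = z} y
      · obtain ⟨y, hy⟩ := hy
        exact ⟨y, fun _ => hy⟩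
      · exact ⟨0, fun h => absurd h hy⟩)
  have hset : ∀ i : J, {z | ∃ j, ∃ _ : j < i, f j = z} = f '' Iio i := by
    intro i; ext z; simp
  simp only [hset] at hf
  have hex : ∃ i : J, ¬ ∃ y, Bd (f '' Iio i) y := by
    by_contra! hall
    have hinj : Function.Injective f := by
      intro i j hij
      by_contra hne
      have key : ∀ i j : J, i < j → f i ≠ f j := by
        intro i j hlt heq
        have := (hf j (hall j)).2 (f i) ⟨i, hlt, rfl⟩
        rw [heq] at this
        exact (this.exists).elim fun n hn => lt_irrefl _ hn
      rcases lt_or_gt_of_ne hne with h | h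
      · exact key _ _ h hij
      · exact key _ _ h hij.symm
    have := Cardinal.mk_le_of_injective hinj
    rw [Cardinal.mk_toType, Cardinal.card_ord] at this
    exact absurd this (not_le.2 (Order.lt_succ _))
  -- The scale is cut at the first stage without a bound. A function dominating the scale, or a
  -- countable cofinal subset of it, would supply the missing bound.
  let i₀ : J := (wellFounded_lt (α := J)).min {i | ¬ ∃ y, Bd (f '' Iio i) y} hex
  have hi₀ : ¬ ∃ y, Bd (f '' Iio i₀) y :=
    (wellFounded_lt (α := J)).min_mem {i | ¬ ∃ y, Bd (f '' Iio i) y} hex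
  have hlt : ∀ i < i₀, Bd (f '' Iio i) (f i) := by
    intro i hi
    refine hf i ?_
    by_contra hcon
    exact (wellFounded_lt (α := J)).not_lt_min {i | ¬ ∃ y, Bd (f '' Iio i) y} hcon hi
  have hincr : ∀ i j : Iio i₀, i < j → ∀ᶠ n in atTop, f i n < f j n :=
    fun i j hij => (hlt j j.2).2 (f i) ⟨i, hij, rfl⟩
  refine ⟨Iio i₀, inferInstance, inferInstance, fun i => f i, ⟨fun i => (hlt i i.2).1,
    fun i j hij => (hincr i j hij).mono fun n hn => hn.le, ?_, ?_⟩⟩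
  · intro w
    by_contra! hcon
    obtain ⟨g, hg, hwg⟩ := exists_monotone_eventually_gt (fun _ => w)
    refine hi₀ ⟨g, hg, ?_⟩
    rintro _ ⟨i, hi, rfl⟩
    have := hcon ⟨i, hi⟩
    filter_upwards [this, hwg 0] with n h1 h2
    exact h1.trans_lt h2
  · intro s
    by_contra! hcon
    obtain ⟨g, hg, hwg⟩ := exists_monotone_eventually_gt (fun k => f (s k))
    refine hi₀ ⟨g, hg, ?_⟩
    rintro _ ⟨i, hi, rfl⟩
    obtain ⟨k, hk⟩ := hcon ⟨i, hi⟩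
    rcases hk.eq_or_lt with h | h
    · have h2 := hwg k
      rw [← h] at h2
      exact h2
    · filter_upwards [hincr _ _ h, hwg k] with n h1 h2
      exact h1.trans h2

/-- Sending m to an element of N beyond m and using monotonicity of the scale functions transfers
unboundedness from ω to N. -/
theorem IsScale.exists_frequently {I : Type} [LinearOrder I] {h : I → ℕ → ℕ} (hh : IsScale h)
    {N : Set ℕ} (hN : N.Infinite) (w : ℕ → ℕ) : ∃ i, {n ∈ N | w n ≤ h i n}.Infinite := by
  classical
  have hnext : ∀ m, ∃ n ∈ N, m ≤ n := fun m => by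
    obtain ⟨n, hn, hmn⟩ := hN.exists_gt m
    exact ⟨n, hn, hmn.le⟩
  choose nx hnx hle using hnext
  obtain ⟨i, hi⟩ := hh.unbounded (fun m => w (nx m))
  refine ⟨i, ?_⟩
  rw [← Nat.frequently_atTop_iff_infinite, frequently_atTop]
  intro b
  obtain ⟨m, hm, hlt⟩ := (frequently_atTop.1 hi) b
  exact ⟨nx m, hm.trans (hle m), hnx m, hlt.le.trans (hh.mono i (hle m))⟩

/-- A well-order of type `𝔠` in which countable sets are bounded and initial segments are small. -/
theorem exists_wellOrder_continuum : ∃ (J : Type) (_ : LinearOrder J) (_ : WellFoundedLT J),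
    Cardinal.mk J = Cardinal.continuum ∧ (∀ i : J, Cardinal.mk (Iio i) < Cardinal.continuum) ∧
    (∀ s : ℕ → J, ∃ i, ∀ k, s k < i) := by
  have hIio : ∀ i : Cardinal.continuum.{0}.ord.ToType,
      Cardinal.mk (Iio i) < Cardinal.continuum := fun i => by
    simpa using Cardinal.mk_Iio_lt i (by simp)
  refine ⟨Cardinal.continuum.ord.ToType, inferInstance, inferInstance, by simp, hIio, ?_⟩
  intro s
  by_contra! hcon
  have hcov : (⋃ k, Iic (s k)) = univ := by
    ext i; simpa using hcon i
  have hIic : ∀ k, Cardinal.mk (Iic (s k)) < Cardinal.continuum := by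
    intro k
    rw [← Iio_insert]
    refine (Cardinal.mk_insert_le).trans_lt ?_
    exact Cardinal.add_lt_of_lt Cardinal.aleph0_le_continuum (hIio _)
      (by simpa using Cardinal.nat_lt_continuum 1)
  -- König's inequality: a countable union of sets smaller than 𝔠 is smaller than 𝔠^ℵ₀ = 𝔠.
  have h1 := Cardinal.sum_lt_prod _ _ hIic
  have h2 := (Cardinal.mk_iUnion_le_sum_mk (f := fun k => Iic (s k))).trans_lt h1
  rw [hcov] at h2
  simp at h2

/-! ### Convergence to a filter and positive sets -/

/-- `a` is almost contained in every member of `F`. -/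
def ConvergesTo (a : Set ℕ) (F : Filter ℕ) : Prop := ∀ D ∈ F, (a \ D).Finite

/-- `B` is positive for `F`, where a filter `F` with decreasing base `D₀, D₁, …` is thought of as
the grid with the columns `Dₙ \ Dₙ₊₁`: infinitely many columns meet `B` in an infinite set, up to
merging finitely many neighbouring columns. -/
def IsPositive (F : Filter ℕ) (B : Set ℕ) : Prop :=
  ∀ D ∈ F, ∃ D' ∈ F, ((B ∩ D) \ D').Infinite

theorem ConvergesTo.mono_filter {a : Set ℕ} {F G : Filter ℕ} (h : ConvergesTo a G) (hGF : G ≤ F) :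
    ConvergesTo a F := fun D hD => h D (hGF hD)

theorem ConvergesTo.subset {a b : Set ℕ} {F : Filter ℕ} (h : ConvergesTo a F) (hba : b ⊆ a) :
    ConvergesTo b F := fun D hD => (h D hD).subset (sdiff_subset_sdiff_left hba)

theorem ConvergesTo.infinite_inter {a D : Set ℕ} {F : Filter ℕ} (h : ConvergesTo a F)
    (ha : a.Infinite) (hD : D ∈ F) : (a ∩ D).Infinite := by
  intro hfin
  exact ha ((hfin.union (h D hD)).subset fun x hx => by
    by_cases hxD : x ∈ D
    · exact Or.inl ⟨hx, hxD⟩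
    · exact Or.inr ⟨hx, hxD⟩)

theorem ConvergesTo.finite_inter_of_compl_mem {a b : Set ℕ} {F : Filter ℕ} (h : ConvergesTo a F)
    (hb : bᶜ ∈ F) : (a ∩ b).Finite :=
  (h _ hb).subset fun _ hx => ⟨hx.1, fun hn => hn hx.2⟩

theorem ConvergesTo.finite_inter {a b : Set ℕ} {F G : Filter ℕ} (ha : ConvergesTo a F)
    (hb : ConvergesTo b G) (hFG : Disjoint F G) : (a ∩ b).Finite := by
  obtain ⟨s, hs, t, ht, hst⟩ := Filter.disjoint_iff.1 hFG
  refine ((ha s hs).union (hb t ht)).subset fun x hx => ?_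
  by_cases hxs : x ∈ s
  · exact Or.inr ⟨hx.2, fun hxt => disjoint_left.1 hst hxs hxt⟩
  · exact Or.inl ⟨hx.1, hxs⟩

theorem IsPositive.infinite_inter {F : Filter ℕ} {B D : Set ℕ} (h : IsPositive F B) (hD : D ∈ F) :
    (B ∩ D).Infinite := by
  obtain ⟨D', _, hinf⟩ := h D hD
  exact hinf.mono sdiff_subset

theorem IsPositive.neBot {F : Filter ℕ} {B : Set ℕ} (h : IsPositive F B) : F.NeBot := by
  refine neBot_iff.2 fun hbot => ?_
  have := h.infinite_inter (D := ∅) (by simp [hbot])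
  simp at this

/-- The grid function sends k to the first member of a decreasing base that omits k; such a member
exists because the filter refines the cofinite one. -/
theorem exists_eq_comap_atTop (F : Filter ℕ) [F.IsCountablyGenerated] (hF : F ≤ cofinite) :
    ∃ f : ℕ → ℕ, F = comap f atTop := by
  classical
  obtain ⟨x, hx⟩ := F.exists_antitone_basis
  have hex : ∀ k, ∃ n, k ∉ x n := by
    intro k
    have : ({k}ᶜ : Set ℕ) ∈ F := hF (by simp)
    obtain ⟨n, -, hn⟩ := hx.1.mem_iff.1 this
    exact ⟨n, fun hk => hn hk rfl⟩
  refine ⟨fun k => Nat.find (hex k), ?_⟩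
  have key : ∀ k n, n + 1 ≤ Nat.find (hex k) ↔ k ∈ x n := by
    intro k n
    rw [Nat.succ_le_iff, Nat.lt_find_iff]
    constructor
    · intro h
      exact not_not.1 (h n le_rfl)
    · intro h m hm
      exact not_not.2 (hx.2 hm h)
  apply le_antisymm
  · rw [← tendsto_iff_comap, tendsto_atTop]
    intro b
    filter_upwards [hx.1.mem_of_mem (i := b) trivial] with k hk
    exact ((Nat.le_succ b).trans ((key k b).2 hk))
  · intro s hs
    obtain ⟨n, -, hn⟩ := hx.1.mem_iff.1 hs
    exact ⟨Ici (n + 1), Ici_mem_atTop _, fun k hk => hn ((key k n).1 hk)⟩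

/-! ### Children of a node, from a scale -/

/-- The children of a node `F` of the tree of filters, given a set `a` converging to `F` from which
all children have to stay away. -/
structure IsChildFamily (F : Filter ℕ) (a : Set ℕ) (𝒢 : Set (Filter ℕ)) : Prop where
  countablyGenerated : ∀ G ∈ 𝒢, G.IsCountablyGenerated
  neBot : ∀ G ∈ 𝒢, G.NeBot
  le : ∀ G ∈ 𝒢, G ≤ F
  compl_mem : ∀ G ∈ 𝒢, aᶜ ∈ G
  disjoint : ∀ G ∈ 𝒢, ∀ H ∈ 𝒢, G ≠ H → Disjoint G H
  splits : ∀ B, IsPositive F B → ∃ G ∈ 𝒢, ∃ H ∈ 𝒢, G ≠ H ∧ IsPositive G B ∧ IsPositive H B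
  exists_positive : ∀ (B : Set ℕ) (G : ℕ → Filter ℕ) (b : ℕ → Set ℕ), (∀ k, G k ∈ 𝒢) →
    Function.Injective G → (∀ k, (b k).Infinite) → (∀ k, b k ⊆ B) →
    (∀ k, ConvergesTo (b k) (G k)) → ∃ H ∈ 𝒢, IsPositive H B

section Children

/-- The part of `ℕ` below the graph of `g`, in the grid with columns the fibres of `f`. -/
def belowGraph (f g : ℕ → ℕ) : Set ℕ := {x | x ≤ g (f x)}

theorem belowGraph_converges (f : ℕ → ℕ) {g : ℕ → ℕ} (hg : Monotone g) :
    ConvergesTo (belowGraph f g) (comap f atTop) := by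
  rintro D ⟨t, ht, htD⟩
  obtain ⟨n, hn⟩ := mem_atTop_sets.1 ht
  refine (finite_Iic (g n)).subset fun x hx => ?_
  have hfx : f x ≤ n := by
    by_contra hcon
    exact hx.2 (htD (hn _ (not_le.1 hcon).le))
  exact hx.1.trans (hg hfx)

variable {I : Type} [LinearOrder I] {h : I → ℕ → ℕ}

theorem IsScale.finite_diff (hh : IsScale h) (f : ℕ → ℕ) {i j : I} (hij : i ≤ j) :
    (belowGraph f (h i) \ belowGraph f (h j)).Finite := by
  rcases hij.eq_or_lt with rfl | hlt
  · simp
  obtain ⟨n, hn⟩ := eventually_atTop.1 (hh.increasing i j hlt)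
  refine (finite_Iic (h i n)).subset fun x hx => ?_
  have hfx : f x ≤ n := by
    by_contra hcon
    exact hx.2 (show x ≤ _ from le_trans hx.1 (hn _ (not_le.1 hcon).le))
  exact le_trans hx.1 (hh.mono i hfx)

/-- The filter of the sets that converge to the grid `f`, avoid `a`, and lie below the graph of
`h ξ` but almost above the graph of `h η` for `η < ξ`. -/
def scaleFilter (h : I → ℕ → ℕ) (f : ℕ → ℕ) (a : Set ℕ) (ξ : I) : Filter ℕ :=
  comap f atTop ⊓ 𝓟 aᶜ ⊓ 𝓟 (belowGraph f (h ξ)) ⊓ ⨅ η : Iio ξ, 𝓟 (belowGraph f (h η))ᶜ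

theorem scaleFilter_le (f : ℕ → ℕ) (a : Set ℕ) (ξ : I) :
    scaleFilter h f a ξ ≤ comap f atTop :=
  inf_le_left.trans (inf_le_left.trans inf_le_left)

theorem compl_mem_scaleFilter (f : ℕ → ℕ) (a : Set ℕ) (ξ : I) : aᶜ ∈ scaleFilter h f a ξ :=
  (inf_le_left.trans (inf_le_left.trans inf_le_right) :
    scaleFilter h f a ξ ≤ 𝓟 aᶜ) (mem_principal_self _)

theorem belowGraph_mem_scaleFilter (f : ℕ → ℕ) (a : Set ℕ) (ξ : I) :
    belowGraph f (h ξ) ∈ scaleFilter h f a ξ :=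
  (inf_le_left.trans inf_le_right :
    scaleFilter h f a ξ ≤ 𝓟 (belowGraph f (h ξ))) (mem_principal_self _)

theorem compl_belowGraph_mem_scaleFilter (f : ℕ → ℕ) (a : Set ℕ) {η ξ : I} (hη : η < ξ) :
    (belowGraph f (h η))ᶜ ∈ scaleFilter h f a ξ :=
  (inf_le_right.trans (iInf_le (fun η : Iio ξ => 𝓟 (belowGraph f (h η))ᶜ) ⟨η, hη⟩) :
    scaleFilter h f a ξ ≤ 𝓟 (belowGraph f (h η))ᶜ) (mem_principal_self _)

theorem scaleFilter_disjoint (f : ℕ → ℕ) (a : Set ℕ) {ξ η : I} (hne : ξ ≠ η) :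
    Disjoint (scaleFilter h f a ξ) (scaleFilter h f a η) := by
  have key : ∀ ξ η : I, ξ < η → Disjoint (scaleFilter h f a ξ) (scaleFilter h f a η) :=
    fun ξ η hlt => Filter.disjoint_iff.2 ⟨_, belowGraph_mem_scaleFilter f a ξ, _,
      compl_belowGraph_mem_scaleFilter f a hlt, disjoint_compl_right⟩
  rcases lt_or_gt_of_ne hne with hlt | hlt
  · exact key _ _ hlt
  · exact (key _ _ hlt).symm

/-- The limit of a strictly increasing sequence of indices between which `B` has points gives a
countably generated filter for which `B` is positive. -/
theorem scaleFilter_positive (hh : IsScale h) {f : ℕ → ℕ} {a B : Set ℕ}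
    (hf : comap f atTop ≤ cofinite) {s : ℕ → I} (hs : StrictMono s)
    {ξ : I} (hξ : IsLUB (range s) ξ)
    (hB : ∀ k, ((B \ a) ∩ (belowGraph f (h (s (k + 1))) \ belowGraph f (h (s k)))).Infinite) :
    (scaleFilter h f a ξ).IsCountablyGenerated ∧ IsPositive (scaleFilter h f a ξ) B := by
  have hlt : ∀ k, s k < ξ := fun k => (hs (Nat.lt_succ_self k)).trans_le (hξ.1 ⟨k + 1, rfl⟩)
  have hcof : ∀ η < ξ, ∃ k, η < s k := by
    intro η hη
    obtain ⟨_, ⟨k, rfl⟩, hk⟩ := (lt_isLUB_iff hξ).1 hη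
    exact ⟨k, hk⟩
  constructor
  · have heq : scaleFilter h f a ξ = comap f atTop ⊓ 𝓟 aᶜ ⊓ 𝓟 (belowGraph f (h ξ)) ⊓
        ⨅ k : ℕ, 𝓟 (belowGraph f (h (s k)))ᶜ := by
      apply le_antisymm
      · refine le_inf inf_le_left (le_iInf fun k => ?_)
        exact le_principal_iff.2 (compl_belowGraph_mem_scaleFilter f a (hlt k))
      · refine le_inf inf_le_left (le_iInf fun η => ?_)
        obtain ⟨k, hk⟩ := hcof η η.2
        rw [le_principal_iff]
        have h1 : (belowGraph f (h (s k)))ᶜ ∈ comap f atTop ⊓ 𝓟 aᶜ ⊓ 𝓟 (belowGraph f (h ξ)) ⊓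
            ⨅ k : ℕ, 𝓟 (belowGraph f (h (s k)))ᶜ :=
          mem_inf_of_right (mem_iInf_of_mem k (mem_principal_self _))
        have h2 : (belowGraph f (h η) \ belowGraph f (h (s k)))ᶜ ∈
            comap f atTop ⊓ 𝓟 aᶜ ⊓ 𝓟 (belowGraph f (h ξ)) ⊓
            ⨅ k : ℕ, 𝓟 (belowGraph f (h (s k)))ᶜ :=
          mem_inf_of_left (mem_inf_of_left (mem_inf_of_left
            (hf (hh.finite_diff f hk.le).compl_mem_cofinite)))
        filter_upwards [h1, h2] with x hx1 hx2 hx3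
        exact hx2 ⟨hx3, hx1⟩
    rw [heq]
    infer_instance
  -- The filter on the left consists of the sets that, for all large k, contain almost all of the
  -- k-th piece of `B \ a` between consecutive graphs. So every member of the scale filter absorbs
  -- almost all of each late piece.
  · have hE : atTop.bind (fun k => cofinite ⊓ 𝓟
        ((B \ a) ∩ (belowGraph f (h (s (k + 1))) \ belowGraph f (h (s k))))) ≤
        scaleFilter h f a ξ := by
      have hmem : ∀ (C D : Set ℕ), (C \ D).Finite → D ∈ cofinite ⊓ 𝓟 C := by
        intro C D hfin
        rw [mem_inf_principal, mem_cofinite]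
        exact hfin.subset fun x hx => by simpa using hx
      refine le_inf (le_inf (le_inf ?_ ?_) ?_) (le_iInf fun η => ?_)
      · intro D hD
        rw [mem_bind']
        refine Eventually.of_forall fun k => hmem _ _ ?_
        exact (belowGraph_converges f (hh.mono (s (k + 1))) D hD).subset
          fun x hx => ⟨hx.1.2.1, hx.2⟩
      · rw [le_principal_iff, mem_bind']
        refine Eventually.of_forall fun k => hmem _ _ ?_
        refine Set.finite_empty.subset fun x hx => hx.2 hx.1.1.2
      · rw [le_principal_iff, mem_bind']
        refine Eventually.of_forall fun k => hmem _ _ ?_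
        exact (hh.finite_diff f (hlt (k + 1)).le).subset fun x hx => ⟨hx.1.2.1, hx.2⟩
      · rw [le_principal_iff, mem_bind']
        obtain ⟨k, hk⟩ := hcof η η.2
        filter_upwards [eventually_ge_atTop k] with j hj
        refine hmem _ _ ((hh.finite_diff f (hk.le.trans (hs.monotone hj))).subset fun x hx => ?_)
        exact ⟨not_not.1 hx.2, hx.1.2.2⟩
    intro D hD
    have hev := mem_bind'.1 (hE hD)
    obtain ⟨k, hk⟩ := (eventually_atTop.1 hev)
    have hk := hk k le_rfl
    rw [mem_inf_principal, mem_cofinite] at hk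
    -- The k-th piece lies below the graph of `h (s (k + 1))`, so it avoids this `D'` entirely,
    -- while almost all of it lies in D.
    refine ⟨_, compl_belowGraph_mem_scaleFilter f a (hlt (k + 1)), ?_⟩
    intro hfin
    refine hB k ((hfin.union hk).subset fun x hx => ?_)
    by_cases hxD : x ∈ D
    · exact Or.inl ⟨⟨hx.1.1, hxD⟩, fun hn => hn hx.2.1⟩
    · exact Or.inr fun hn => hxD (hn hx)

theorem exists_isLUB_of_countably_bounded [WellFoundedLT I] (hh : IsScale h) (s : ℕ → I) :
    ∃ ξ, IsLUB (range s) ξ := by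
  obtain ⟨i, hi⟩ := hh.countably_bounded s
  have hne : (upperBounds (range s)).Nonempty := ⟨i, by rintro _ ⟨k, rfl⟩; exact (hi k).le⟩
  exact ⟨(wellFounded_lt (α := I)).min _ hne, (wellFounded_lt (α := I)).min_mem _ hne,
    fun b hb => (wellFounded_lt (α := I)).min_le hb⟩

/-- Positivity gives infinitely many columns in which `B \ a` is infinite. A point of `B \ a` above
the i-th graph is chosen in each of them, and some scale function catches infinitely many of these
points. -/
theorem IsScale.exists_infinite_between (hh : IsScale h) {f : ℕ → ℕ} {a B : Set ℕ}
    (ha : ConvergesTo a (comap f atTop)) (hB : IsPositive (comap f atTop) B) (i : I) :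
    ∃ j, i < j ∧ ((B \ a) ∩ (belowGraph f (h j) \ belowGraph f (h i))).Infinite := by
  have hIci : ∀ m, {x | m ≤ f x} ∈ comap f atTop := fun m => ⟨Ici m, Ici_mem_atTop m, fun _ => id⟩
  have hN : {n | ((B \ a) ∩ {x | f x = n}).Infinite}.Infinite := by
    rw [← Nat.frequently_atTop_iff_infinite, frequently_atTop]
    intro m
    obtain ⟨D', ⟨t, ht, htD⟩, hinf⟩ := hB _ (hIci m)
    obtain ⟨m', hm'⟩ := mem_atTop_sets.1 ht
    by_contra! hcon
    refine hinf (((ha _ (hIci m')).union ((finite_Ico m m').biUnion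
      (t := fun n => (B \ a) ∩ {x | f x = n}) fun n hn => ?_)).subset fun x hx => ?_)
    · exact hcon n hn.1
    · have hlt : f x < m' := by
        by_contra hcon
        exact hx.2 (htD (hm' _ (not_lt.1 hcon)))
      by_cases hxa : x ∈ a
      · exact Or.inl ⟨hxa, not_le.2 hlt⟩
      · exact Or.inr (mem_biUnion (show f x ∈ Ico m m' from ⟨hx.1.2, hlt⟩) ⟨⟨hx.1.1, hxa⟩, rfl⟩)
  have hw : ∀ n, ∃ x, ((B \ a) ∩ {x | f x = n}).Infinite → x ∈ B \ a ∧ f x = n ∧ h i n < x := by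
    intro n
    by_cases hn : ((B \ a) ∩ {x | f x = n}).Infinite
    · obtain ⟨x, hx, hlt⟩ := hn.exists_gt (h i n)
      exact ⟨x, fun _ => ⟨hx.1, hx.2, hlt⟩⟩
    · exact ⟨0, fun hcon => absurd hcon hn⟩
  choose w hw using hw
  obtain ⟨j, hj⟩ := hh.exists_frequently hN w
  have hinf : ((B \ a) ∩ (belowGraph f (h j) \ belowGraph f (h i))).Infinite := by
    refine (hj.image (f := w) ?_).mono ?_
    · intro n hn m hm hnm
      rw [← (hw n hn.1).2.1, ← (hw m hm.1).2.1, hnm]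
    · rintro _ ⟨n, hn, rfl⟩
      obtain ⟨h1, h2, h3⟩ := hw n hn.1
      refine ⟨h1, ?_, ?_⟩
      · show w n ≤ h j (f (w n))
        rw [h2]; exact hn.2
      · show ¬ w n ≤ h i (f (w n))
        rw [h2]; exact not_le.2 h3
  refine ⟨j, ?_, hinf⟩
  by_contra hcon
  exact hinf ((hh.finite_diff f (not_lt.1 hcon)).subset inter_subset_right)

end Children

/-- The children are those scale filters that are proper and countably generated. Suprema of
strictly increasing ω-sequences of indices provide enough of them: such a sequence is built from a
positive set for `splits`, and extracted from the given distinct children for `exists_positive`. -/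
theorem exists_isChildFamily (F : Filter ℕ) [F.IsCountablyGenerated] (hF : F ≤ cofinite)
    {a : Set ℕ} (ha : ConvergesTo a F) : ∃ 𝒢, IsChildFamily F a 𝒢 := by
  obtain ⟨f, rfl⟩ := exists_eq_comap_atTop F hF
  obtain ⟨I, _, _, h, hh⟩ := exists_scale
  have hpos : ∀ B, IsPositive (comap f atTop) B → ∀ i, ∃ ξ, i < ξ ∧
      (scaleFilter h f a ξ).IsCountablyGenerated ∧ IsPositive (scaleFilter h f a ξ) B := by
    intro B hB i
    choose nx hlt hnx using hh.exists_infinite_between ha hB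
    let s : ℕ → I := fun k => nx^[k] i
    have hsucc : ∀ k, s (k + 1) = nx (s k) := fun k => Function.iterate_succ_apply' nx k i
    have hs : StrictMono s := strictMono_nat_of_lt_succ fun k => by rw [hsucc]; exact hlt _
    obtain ⟨ξ, hξ⟩ := exists_isLUB_of_countably_bounded hh s
    refine ⟨ξ, ?_, scaleFilter_positive hh hF hs hξ fun k => ?_⟩
    · exact (hs Nat.zero_lt_one).trans_le (hξ.1 ⟨1, rfl⟩)
    · rw [hsucc]; exact hnx _
  refine ⟨{G | ∃ ξ, G = scaleFilter h f a ξ ∧ G.IsCountablyGenerated ∧ G.NeBot},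
    ?_, ?_, ?_, ?_, ?_, ?_, ?_⟩
  · rintro G ⟨ξ, -, hG, -⟩
    exact hG
  · rintro G ⟨ξ, -, -, hG⟩
    exact hG
  · rintro G ⟨ξ, rfl, -⟩
    exact scaleFilter_le f a ξ
  · rintro G ⟨ξ, rfl, -⟩
    exact compl_mem_scaleFilter f a ξ
  · rintro G ⟨ξ, rfl, -⟩ H ⟨η, rfl, -⟩ hne
    exact scaleFilter_disjoint f a fun heq => hne (by rw [heq])
  · intro B hB
    obtain ⟨i₀, -⟩ := hh.unbounded 0
    obtain ⟨ξ, -, hξ, hξB⟩ := hpos B hB i₀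
    obtain ⟨η, hlt, hη, hηB⟩ := hpos B hB ξ
    refine ⟨_, ⟨ξ, rfl, hξ, hξB.neBot⟩, _, ⟨η, rfl, hη, hηB.neBot⟩, ?_, hξB, hηB⟩
    intro heq
    have hd := scaleFilter_disjoint (h := h) f a hlt.ne
    rw [heq, disjoint_self] at hd
    exact hηB.neBot.ne hd
  · intro B G b hG hinj hb hbB hbG
    choose ξ hξ _ _ using hG
    have hξinj : Function.Injective ξ := fun i j hij => hinj (by rw [hξ i, hξ j, hij])
    -- The indices are distinct and well-ordered, so the nonincreasing alternative would be an
    -- infinite descent.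
    obtain ⟨g, hg⟩ := exists_increasing_or_nonincreasing_subseq (· < ·) ξ
    have hs : StrictMono (ξ ∘ g) := by
      rcases hg with hg | hg
      · exact fun m n hmn => hg m n hmn
      · have hanti : ∀ m n, m < n → ξ (g n) < ξ (g m) := fun m n hmn =>
          lt_of_le_of_ne (not_lt.1 (hg m n hmn)) fun heq =>
            hmn.ne' (g.injective (hξinj heq))
        exact absurd (wellFounded_lt (α := I)) (RelEmbedding.not_wellFounded
          (RelEmbedding.natGT (r := ((· < ·) : I → I → Prop)) (fun n => ξ (g n))
            fun n => hanti n (n + 1) (Nat.lt_succ_self n)))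
    obtain ⟨ζ, hζ⟩ := exists_isLUB_of_countably_bounded hh (ξ ∘ g)
    have hp := scaleFilter_positive (a := a) (B := B) hh hF hs hζ fun k => by
      have hmem : aᶜ ∩ (belowGraph f (h (ξ (g (k + 1)))) ∩ (belowGraph f (h (ξ (g k))))ᶜ) ∈
          G (g (k + 1)) := by
        rw [hξ (g (k + 1))]
        exact inter_mem (compl_mem_scaleFilter f a _) (inter_mem (belowGraph_mem_scaleFilter f a _)
          (compl_belowGraph_mem_scaleFilter f a (hs (Nat.lt_succ_self k))))
      exact ((hbG _).infinite_inter (hb _) hmem).mono fun x hx =>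
        ⟨⟨hbB _ hx.1, hx.2.1⟩, hx.2.2.1, hx.2.2.2⟩
    exact ⟨_, ⟨ζ, rfl, hp.1, hp.2.neBot⟩, hp.2⟩

open Classical in
/-- A chosen family of children. -/
noncomputable def childFamily (F : Filter ℕ) (a : Set ℕ) : Set (Filter ℕ) :=
  if h : ∃ 𝒢, IsChildFamily F a 𝒢 then h.choose else ∅

theorem isChildFamily_childFamily (F : Filter ℕ) (hc : F.IsCountablyGenerated) (hF : F ≤ cofinite)
    {a : Set ℕ} (ha : ConvergesTo a F) : IsChildFamily F a (childFamily F a) := by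
  have h := exists_isChildFamily F hF ha
  rw [childFamily, dif_pos h]
  exact h.choose_spec

/-! ### The tree of filters -/

/-- The colour classes of `ℕ`. -/
def colourClass (i : ℕ) : Set ℕ := {x | (Nat.unpair x).1 = i}

/-- The root of the tree of filters. -/
def baseGrid : Filter ℕ := comap (fun x => (Nat.unpair (Nat.unpair x).2).1) atTop

theorem baseGrid_le_cofinite : baseGrid ≤ cofinite := by
  rw [le_cofinite_iff_compl_singleton_mem]
  intro x
  refine ⟨Ioi (Nat.unpair (Nat.unpair x).2).1, Ioi_mem_atTop _, fun y hy hyx => ?_⟩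
  rw [mem_singleton_iff] at hyx
  subst hyx
  exact lt_irrefl (Nat.unpair (Nat.unpair y).2).1 hy

theorem baseGrid_positive (i : ℕ) : IsPositive baseGrid (colourClass i) := by
  rintro D ⟨t, ht, htD⟩
  obtain ⟨n, hn⟩ := mem_atTop_sets.1 ht
  refine ⟨_, ⟨Ioi n, Ioi_mem_atTop n, subset_rfl⟩, ?_⟩
  refine (infinite_range_of_injective (f := fun l => Nat.pair i (Nat.pair n l)) ?_).mono ?_
  · intro l m hlm
    simpa using hlm
  · rintro _ ⟨l, rfl⟩
    refine ⟨⟨by simp [colourClass], htD ?_⟩, by simp⟩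
    simpa using hn n le_rfl

/-- The tree of filters generated by a set `Φ` of pairs `(F, a)`, where `a` is the set that the
children of `F` have to avoid. -/
inductive IsNode (Φ : Set (Filter ℕ × Set ℕ)) : Filter ℕ → Prop
  | root : IsNode Φ baseGrid
  | child {F : Filter ℕ} {a : Set ℕ} {G : Filter ℕ} :
      IsNode Φ F → (F, a) ∈ Φ → G ∈ childFamily F a → IsNode Φ G
  | lim {F : ℕ → Filter ℕ} :
      (∀ n, IsNode Φ (F n)) → Directed (· ≥ ·) F → IsNode Φ (⨅ n, F n)

theorem IsNode.mono {Φ Ψ : Set (Filter ℕ × Set ℕ)} (h : Φ ⊆ Ψ) {F : Filter ℕ} (hF : IsNode Φ F) :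
    IsNode Ψ F := by
  induction hF with
  | root => exact .root
  | child _ hmem hG ih => exact .child ih (h hmem) hG
  | lim _ hd ih => exact .lim ih hd

/-- Sets `Φ` of pairs `(F, a)` where every `F` is a node of the tree, has only one `a`, and `a` is an
infinite set converging to `F`. -/
structure IsSystem (Φ : Set (Filter ℕ × Set ℕ)) : Prop where
  functional : ∀ F a b, (F, a) ∈ Φ → (F, b) ∈ Φ → a = b
  isNode : ∀ F a, (F, a) ∈ Φ → IsNode Φ F
  infinite : ∀ F a, (F, a) ∈ Φ → a.Infinite
  converges : ∀ F a, (F, a) ∈ Φ → ConvergesTo a F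

/-- `F` lies below a child of `G`. -/
def IsBelow (Φ : Set (Filter ℕ × Set ℕ)) (F G : Filter ℕ) : Prop :=
  ∃ a H, (G, a) ∈ Φ ∧ H ∈ childFamily G a ∧ F ≤ H

theorem IsBelow.trans_le {Φ : Set (Filter ℕ × Set ℕ)} {F F' G : Filter ℕ} (h : IsBelow Φ F' G)
    (hle : F ≤ F') : IsBelow Φ F G := by
  obtain ⟨a, H, hmem, hH, hF'⟩ := h
  exact ⟨a, H, hmem, hH, hle.trans hF'⟩

section Tree

variable {Φ : Set (Filter ℕ × Set ℕ)}

theorem IsSystem.node_props (hΦ : IsSystem Φ) {F : Filter ℕ} (hF : IsNode Φ F) :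
    F.IsCountablyGenerated ∧ F.NeBot ∧ F ≤ baseGrid := by
  induction hF with
  | root => exact ⟨by unfold baseGrid; infer_instance, (baseGrid_positive 0).neBot, le_rfl⟩
  | child _ hmem hG ih =>
    have hfam := isChildFamily_childFamily _ ih.1 (ih.2.2.trans baseGrid_le_cofinite)
      (hΦ.converges _ _ hmem)
    exact ⟨hfam.countablyGenerated _ hG, hfam.neBot _ hG, (hfam.le _ hG).trans ih.2.2⟩
  | lim _ hd ih =>
    have := fun n => (ih n).1
    exact ⟨inferInstance, iInf_neBot_of_directed hd fun n => (ih n).2.1,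
      (iInf_le _ 0).trans (ih 0).2.2⟩

theorem IsSystem.le_cofinite (hΦ : IsSystem Φ) {F : Filter ℕ} (hF : IsNode Φ F) :
    F ≤ cofinite := (hΦ.node_props hF).2.2.trans baseGrid_le_cofinite

theorem IsSystem.isChildFamily (hΦ : IsSystem Φ) {F : Filter ℕ} {a : Set ℕ} (hmem : (F, a) ∈ Φ) :
    IsChildFamily F a (childFamily F a) :=
  have hF := hΦ.isNode _ _ hmem
  isChildFamily_childFamily F (hΦ.node_props hF).1 (hΦ.le_cofinite hF) (hΦ.converges _ _ hmem)

theorem IsSystem.isBelow_le (hΦ : IsSystem Φ) {F G : Filter ℕ} (h : IsBelow Φ F G) : F ≤ G := by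
  obtain ⟨a, H, hmem, hH, hle⟩ := h
  exact hle.trans ((hΦ.isChildFamily hmem).le H hH)

theorem IsSystem.compl_mem (hΦ : IsSystem Φ) {F G : Filter ℕ} {a : Set ℕ} (h : IsBelow Φ F G)
    (hmem : (G, a) ∈ Φ) : aᶜ ∈ F := by
  obtain ⟨b, H, hmem', hH, hle⟩ := h
  obtain rfl := hΦ.functional _ _ _ hmem hmem'
  exact hle ((hΦ.isChildFamily hmem).compl_mem H hH)

theorem IsSystem.not_isBelow_self (hΦ : IsSystem Φ) {F : Filter ℕ} : ¬ IsBelow Φ F F := by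
  intro h
  obtain ⟨a, H, hmem, hH, hle⟩ := id h
  have := (hΦ.converges _ _ hmem).finite_inter_of_compl_mem (hΦ.compl_mem h hmem)
  rw [inter_self] at this
  exact hΦ.infinite _ _ hmem this

/-- Two nodes are equal, or one lies below a child of the other, or they are disjoint. -/
def TreeComparable (Φ : Set (Filter ℕ × Set ℕ)) (F G : Filter ℕ) : Prop :=
  F = G ∨ IsBelow Φ F G ∨ IsBelow Φ G F ∨ Disjoint F G

theorem TreeComparable.symm {F G : Filter ℕ} (h : TreeComparable Φ F G) :
    TreeComparable Φ G F := by
  rcases h with h | h | h | h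
  · exact Or.inl h.symm
  · exact Or.inr (Or.inr (Or.inl h))
  · exact Or.inr (Or.inl h)
  · exact Or.inr (Or.inr (Or.inr h.symm))

/-- Passing from a node to one of its children settles everything except the case `F ≤ G'`, which is
left to the caller. -/
theorem IsSystem.treeComparable_child (hΦ : IsSystem Φ) {F G G' : Filter ℕ} {a : Set ℕ}
    (hmem : (G, a) ∈ Φ) (hG' : G' ∈ childFamily G a) (h : TreeComparable Φ F G)
    (hle : F ≤ G' → TreeComparable Φ F G') : TreeComparable Φ F G' := by
  have hfam := hΦ.isChildFamily hmem
  rcases h with rfl | ⟨b, H, hmem', hH, hFH⟩ | h | h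
  · exact Or.inr (Or.inr (Or.inl ⟨a, G', hmem, hG', le_rfl⟩))
  · obtain rfl := hΦ.functional _ _ _ hmem hmem'
    by_cases hne : H = G'
    · exact hle (hne ▸ hFH)
    · exact Or.inr (Or.inr (Or.inr ((hfam.disjoint _ hH _ hG' hne).mono_left hFH)))
  · exact Or.inr (Or.inr (Or.inl (h.trans_le (hfam.le _ hG'))))
  · exact Or.inr (Or.inr (Or.inr (h.mono_right (hfam.le _ hG'))))

theorem IsSystem.treeComparable_iInf (hΦ : IsSystem Φ) {F : Filter ℕ} {G : ℕ → Filter ℕ}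
    (h : ∀ n, TreeComparable Φ F (G n))
    (hle : F ≤ ⨅ n, G n → TreeComparable Φ F (⨅ n, G n)) :
    TreeComparable Φ F (⨅ n, G n) := by
  by_cases hall : ∀ n, F ≤ G n
  · exact hle (le_iInf hall)
  push Not at hall
  obtain ⟨n, hn⟩ := hall
  rcases h n with h | h | h | h
  · exact absurd h.le hn
  · exact absurd (hΦ.isBelow_le h) hn
  · exact Or.inr (Or.inr (Or.inl (h.trans_le (iInf_le _ n))))
  · exact Or.inr (Or.inr (Or.inr (h.mono_right (iInf_le _ n))))

/-- Inner half of a double induction: the induction on G leaves only `F ≤ G` open, and `hred`,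
supplied by the outer induction on F, leaves only `G ≤ F`. Together they give equality. -/
theorem IsSystem.treeComparable_of_le (hΦ : IsSystem Φ) {F G : Filter ℕ} (hG : IsNode Φ G)
    (hF : IsNode Φ F) (hred : ∀ G, IsNode Φ G → (G ≤ F → TreeComparable Φ F G) →
      TreeComparable Φ F G) : TreeComparable Φ F G := by
  induction hG with
  | root => exact hred _ .root fun h => Or.inl (le_antisymm (hΦ.node_props hF).2.2 h)
  | child hG hmem hG' ih =>
    exact hred _ (.child hG hmem hG') fun h1 => hΦ.treeComparable_child hmem hG' ih fun h2 =>
      Or.inl (le_antisymm h2 h1)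
  | lim hG hd ih =>
    exact hred _ (.lim hG hd) fun h1 => hΦ.treeComparable_iInf ih fun h2 =>
      Or.inl (le_antisymm h2 h1)

theorem IsSystem.treeComparable (hΦ : IsSystem Φ) {F G : Filter ℕ} (hF : IsNode Φ F)
    (hG : IsNode Φ G) : TreeComparable Φ F G := by
  induction hF generalizing G with
  | root =>
    exact hΦ.treeComparable_of_le hG .root fun G hG h => h (hΦ.node_props hG).2.2
  | child hF hmem hF' ih =>
    exact hΦ.treeComparable_of_le hG (.child hF hmem hF') fun G hG h =>
      (hΦ.treeComparable_child hmem hF' (ih hG).symm fun hle => (h hle).symm).symm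
  | lim hF hd ih =>
    exact hΦ.treeComparable_of_le hG (.lim hF hd) fun G hG h =>
      (hΦ.treeComparable_iInf (fun n => (ih n hG).symm) fun hle => (h hle).symm).symm

/-- A child adds only itself to the nodes above its parent, and a limit adds only itself to a
countable union of countable sets. This keeps the chain in `exists_positive_node` countable, so that
its infimum is again a node. -/
theorem IsSystem.countable_predecessors (hΦ : IsSystem Φ) {F : Filter ℕ} (hF : IsNode Φ F) :
    {G | IsNode Φ G ∧ F ≤ G}.Countable := by
  have hbot : ∀ {F G H : Filter ℕ}, IsNode Φ F → F ≤ G → F ≤ H → ¬ Disjoint G H := by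
    intro F G H hF hG hH hd
    exact (hΦ.node_props hF).2.1.ne (disjoint_self.1 (hd.mono hG hH))
  induction hF with
  | root =>
    refine (countable_singleton baseGrid).mono fun G hG => ?_
    exact le_antisymm (hΦ.node_props hG.1).2.2 hG.2
  | @child F₁ a F hF₁ hmem hF ih =>
    have hF' := IsNode.child hF₁ hmem hF
    have hle := (hΦ.isChildFamily hmem).le _ hF
    refine (ih.union (countable_singleton F)).mono fun G ⟨hG, hFG⟩ => ?_
    rcases hΦ.treeComparable hF₁ hG with h | h | ⟨b, H, hmem', hH, hGH⟩ | h
    · exact Or.inl ⟨hG, h.le⟩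
    · exact Or.inl ⟨hG, hΦ.isBelow_le h⟩
    · obtain rfl := hΦ.functional _ _ _ hmem hmem'
      by_cases hne : H = F
      · exact Or.inr (le_antisymm (hne ▸ hGH) hFG)
      · exact absurd ((hΦ.isChildFamily hmem).disjoint _ hH _ hF hne)
          (hbot hF' (hFG.trans hGH) le_rfl)
    · exact absurd h (hbot hF' hle hFG)
  | @lim F hF hd ih =>
    refine ((countable_iUnion ih).union (countable_singleton (⨅ n, F n))).mono
      fun G ⟨hG, hFG⟩ => ?_
    by_cases hall : ∀ n, G ≤ F n
    · exact Or.inr (le_antisymm (le_iInf hall) hFG)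
    push Not at hall
    obtain ⟨n, hn⟩ := hall
    refine Or.inl (mem_iUnion.2 ⟨n, hG, ?_⟩)
    rcases hΦ.treeComparable (hF n) hG with h | h | h | h
    · exact h.le
    · exact hΦ.isBelow_le h
    · exact absurd (hΦ.isBelow_le h) hn
    · exact absurd h (hbot (.lim hF hd) (iInf_le _ n) hFG)

theorem IsSystem.finite_inter (hΦ : IsSystem Φ) {F G : Filter ℕ} {a b : Set ℕ}
    (hF : (F, a) ∈ Φ) (hG : (G, b) ∈ Φ) (hne : F ≠ G) : (a ∩ b).Finite := by
  rcases hΦ.treeComparable (hΦ.isNode _ _ hF) (hΦ.isNode _ _ hG) with h | h | h | h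
  · exact absurd h hne
  · exact (hΦ.converges _ _ hF).finite_inter_of_compl_mem (hΦ.compl_mem h hG)
  · rw [inter_comm]
    exact (hΦ.converges _ _ hG).finite_inter_of_compl_mem (hΦ.compl_mem h hF)
  · exact (hΦ.converges _ _ hF).finite_inter (hΦ.converges _ _ hG) h

/-- A pseudo-intersection: one point of B is picked from each member of a decreasing countable base.
-/
theorem exists_infinite_converging {F : Filter ℕ} (hc : F.IsCountablyGenerated) {B : Set ℕ}
    (hB : IsPositive F B) : ∃ a ⊆ B, a.Infinite ∧ ConvergesTo a F := by
  obtain ⟨x, hx⟩ := F.exists_antitone_basis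
  have hy : ∀ n, ∃ y ∈ B ∩ x n, n < y := fun n =>
    (hB.infinite_inter (hx.1.mem_of_mem trivial)).exists_gt n
  choose y hy hlt using hy
  refine ⟨range y, ?_, ?_, ?_⟩
  · rintro _ ⟨n, rfl⟩
    exact (hy n).1
  · exact infinite_of_forall_exists_gt fun n => ⟨y n, ⟨n, rfl⟩, hlt n⟩
  · intro D hD
    obtain ⟨N, -, hN⟩ := hx.1.mem_iff.1 hD
    refine ((finite_Iio N).image y).subset ?_
    rintro _ ⟨⟨n, rfl⟩, hn⟩
    refine ⟨n, ?_, rfl⟩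
    by_contra hcon
    exact hn (hN (hx.2 (not_lt.1 hcon) (hy n).2))

/-- A set which meets infinitely many members of the system in infinite sets is positive for some
node. -/
theorem IsSystem.exists_positive_node (hΦ : IsSystem Φ) {B : Set ℕ} {F : ℕ → Filter ℕ}
    {a : ℕ → Set ℕ} (hmem : ∀ k, (F k, a k) ∈ Φ) (hinj : Function.Injective F)
    (hB : ∀ k, (a k ∩ B).Infinite) : ∃ G, IsNode Φ G ∧ IsPositive G B := by
  have hnode : ∀ k, IsNode Φ (F k) := fun k => hΦ.isNode _ _ (hmem k)
  have hconv : ∀ k, ConvergesTo (a k ∩ B) (F k) := fun k =>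
    (hΦ.converges _ _ (hmem k)).subset inter_subset_left
  let p : Ultrafilter ℕ := hyperfilter ℕ
  -- The branch followed by p-almost all `F k`. It is a countable chain, and its infimum L is the
  -- node where the sequence stops agreeing.
  let R : Set (Filter ℕ) := {G | IsNode Φ G ∧ ∀ᶠ k in p, F k ≤ G}
  have hroot : baseGrid ∈ R :=
    ⟨.root, Eventually.of_forall fun k => (hΦ.node_props (hnode k)).2.2⟩
  have hRc : R.Countable := by
    refine (countable_iUnion fun k => hΦ.countable_predecessors (hnode k)).mono fun G hG => ?_
    obtain ⟨k, hk⟩ := hG.2.exists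
    exact mem_iUnion.2 ⟨k, hG.1, hk⟩
  obtain ⟨r, hr⟩ := hRc.exists_eq_range ⟨_, hroot⟩
  have hrR : ∀ n, r n ∈ R := fun n => hr ▸ mem_range_self n
  have hchain : ∀ G ∈ R, ∀ H ∈ R, G ≤ H ∨ H ≤ G := by
    intro G hG H hH
    obtain ⟨k, hkG, hkH⟩ := (hG.2.and hH.2).exists
    rcases hΦ.treeComparable hG.1 hH.1 with h | h | h | h
    · exact Or.inl h.le
    · exact Or.inl (hΦ.isBelow_le h)
    · exact Or.inr (hΦ.isBelow_le h)
    · exact absurd (disjoint_self.1 (h.mono hkG hkH)) (hΦ.node_props (hnode k)).2.1.ne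
  have hd : Directed (· ≥ ·) r := by
    intro m n
    rcases hchain _ (hrR m) _ (hrR n) with h | h
    · exact ⟨m, le_rfl, h⟩
    · exact ⟨n, h, le_rfl⟩
  let L : Filter ℕ := ⨅ n, r n
  have hL : IsNode Φ L := .lim (fun n => (hrR n).1) hd
  have hLle : ∀ G ∈ R, L ≤ G := by
    intro G hG
    rw [hr] at hG
    obtain ⟨n, rfl⟩ := hG
    exact iInf_le _ n
  by_cases hLR : L ∈ R
  · have hne : ∀ᶠ k in p, F k ≠ L := by
      have hfin : {k | F k = L}.Finite :=
        Set.Subsingleton.finite fun i hi j hj => hinj (Eq.trans hi (Eq.symm hj))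
      exact Ultrafilter.compl_mem_iff_notMem.2 hfin.notMem_hyperfilter
    have hbelow : ∀ᶠ k in p, IsBelow Φ (F k) L := by
      filter_upwards [hne, hLR.2] with k hk1 hk2
      rcases hΦ.treeComparable (hnode k) hL with h | h | h | h
      · exact absurd h hk1
      · exact h
      · exact absurd (h.trans_le hk2) hΦ.not_isBelow_self
      · exact absurd (disjoint_self.1 (h.mono_right hk2)) (hΦ.node_props (hnode k)).2.1.ne
    obtain ⟨k₀, c, -, hc, -⟩ := hbelow.exists
    have hfam := hΦ.isChildFamily hc
    have hH : ∀ k, ∃ H, IsBelow Φ (F k) L → H ∈ childFamily L c ∧ F k ≤ H := by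
      intro k
      by_cases hk : IsBelow Φ (F k) L
      · obtain ⟨b, H, hb, hHmem, hle⟩ := hk
        obtain rfl := hΦ.functional _ _ _ hb hc
        exact ⟨H, fun _ => ⟨hHmem, hle⟩⟩
      · exact ⟨⊥, fun h => absurd h hk⟩
    choose H hH using hH
    -- If only finitely many children occurred, p would concentrate on one of them; that child would
    -- belong to R, putting L below itself.
    have hinf : (H '' {k | IsBelow Φ (F k) L}).Infinite := by
      intro hfin
      have hev : ∀ᶠ k in p, ∃ G ∈ H '' {k | IsBelow Φ (F k) L}, H k = G := by
        filter_upwards [hbelow] with k hk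
        exact ⟨_, ⟨k, hk, rfl⟩, rfl⟩
      obtain ⟨G, ⟨k, hk, rfl⟩, hG⟩ := (Ultrafilter.eventually_exists_mem_iff hfin).1 hev
      have hGR : H k ∈ R := by
        refine ⟨.child hL hc (hH k hk).1, ?_⟩
        filter_upwards [hG, hbelow] with j hj1 hj2
        exact hj1 ▸ (hH j hj2).2
      exact hΦ.not_isBelow_self ⟨c, H k, hc, (hH k hk).1, hLle _ hGR⟩
    have hsel : ∀ n, ∃ k, IsBelow Φ (F k) L ∧ H k = (hinf.natEmbedding _ n : Filter ℕ) :=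
      fun n => (hinf.natEmbedding _ n).2
    choose s hs hsH using hsel
    obtain ⟨G, hG, hGB⟩ := hfam.exists_positive B (fun n => H (s n)) (fun n => a (s n) ∩ B)
      (fun n => (hH _ (hs n)).1)
      (fun m n hmn => (hinf.natEmbedding _).injective
        (Subtype.ext (by rw [← hsH m, ← hsH n]; exact hmn)))
      (fun n => hB _) (fun n => inter_subset_right)
      (fun n => (hconv _).mono_filter (hH _ (hs n)).2)
    exact ⟨G, .child hL hc hG, hGB⟩
  -- Here p-almost all `F k` leave the branch above L. Given D, some `F k` has D as a member but
  -- does not lie below L, so L contains a set omitting an infinite part of `a k ∩ B ∩ D`: the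
  -- complement of `a k`, or a set witnessing that L and `F k` are disjoint.
  · refine ⟨L, hL, fun D hD => ?_⟩
    obtain ⟨n, hn⟩ := (mem_iInf_of_directed hd D).1 hD
    have hnot : ∀ᶠ k in p, ¬ F k ≤ L := by
      rw [Ultrafilter.eventually_not]
      exact fun h => hLR ⟨hL, h⟩
    obtain ⟨k, hk1, hk2⟩ := ((hrR n).2.and hnot).exists
    rcases hΦ.treeComparable hL (hnode k) with h | h | h | h
    · exact absurd h.ge hk2
    · refine ⟨_, hΦ.compl_mem h (hmem k), ?_⟩
      exact ((hconv k).infinite_inter (hB k) (hk1 hn)).mono fun x hx =>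
        ⟨⟨hx.1.2, hx.2⟩, fun hcon => hcon hx.1.1⟩
    · exact absurd (hΦ.isBelow_le h) hk2
    · obtain ⟨s, hs, t, ht, hst⟩ := Filter.disjoint_iff.1 h
      refine ⟨s, hs, ?_⟩
      exact ((hconv k).infinite_inter (hB k) (inter_mem (hk1 hn) ht)).mono fun x hx =>
        ⟨⟨hx.1.2, hx.2.1⟩, fun hcon => disjoint_left.1 hst hcon hx.2.2⟩

theorem IsPositive.iInf {F : ℕ → Filter ℕ} (hd : Directed (· ≥ ·) F) {B : Set ℕ}
    (h : ∀ n, IsPositive (F n) B) : IsPositive (⨅ n, F n) B := by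
  intro D hD
  obtain ⟨n, hn⟩ := (mem_iInf_of_directed hd D).1 hD
  obtain ⟨D', hD', hinf⟩ := h n D hn
  exact ⟨D', iInf_le F n hD', hinf⟩

/-- In a system of fewer than `𝔠` pairs, there is an unused node for which a given set is positive,
provided that there is a node at all for which it is positive. -/
theorem IsSystem.exists_unused_node (hΦ : IsSystem Φ)
    (hcard : Cardinal.mk Φ < Cardinal.continuum) {B : Set ℕ} {F : Filter ℕ} (hF : IsNode Φ F)
    (hB : IsPositive F B) : ∃ G, IsNode Φ G ∧ IsPositive G B ∧ ∀ a, (G, a) ∉ Φ := by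
  by_contra! hcon
  let N := {G : Filter ℕ // IsNode Φ G ∧ IsPositive G B}
  have hsplit : ∀ G : N, ∃ H : Bool → N, (∀ i, (H i : Filter ℕ) ≤ G) ∧
      Disjoint (H true : Filter ℕ) (H false) := by
    intro G
    obtain ⟨a, ha⟩ := hcon G G.2.1 G.2.2
    have hfam := hΦ.isChildFamily ha
    obtain ⟨H, hH, K, hK, hne, hHB, hKB⟩ := hfam.splits B G.2.2
    refine ⟨fun i => bif i then ⟨H, .child G.2.1 ha hH, hHB⟩ else ⟨K, .child G.2.1 ha hK, hKB⟩,
      ?_, hfam.disjoint _ hH _ hK hne⟩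
    rintro (_ | _)
    · exact hfam.le _ hK
    · exact hfam.le _ hH
  choose S hSle hSd using hsplit
  -- If every positive node were used, each would split into two disjoint positive children; the
  -- infima along the 2^ω branches are distinct positive nodes, hence all used.
  let s : (ℕ → Bool) → ℕ → N := fun x n => Nat.rec ⟨F, hF, hB⟩ (fun k G => S G (x k)) n
  have hs1 : ∀ x n, s x (n + 1) = S (s x n) (x n) := fun x n => rfl
  have hanti : ∀ x, Antitone fun n => (s x n).1 := fun x =>
    antitone_nat_of_succ_le fun n => hSle (s x n) (x n)
  have hdir : ∀ x, Directed (· ≥ ·) fun n => (s x n).1 := fun x =>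
    (hanti x).directed_ge
  have hlim : ∀ x, IsNode Φ (⨅ n, (s x n).1) ∧ IsPositive (⨅ n, (s x n).1) B :=
    fun x => ⟨.lim (fun n => (s x n).2.1) (hdir x), .iInf (hdir x) fun n => (s x n).2.2⟩
  have hmem : ∀ x, ∃ a, ((⨅ n, (s x n).1), a) ∈ Φ := fun x => hcon _ (hlim x).1 (hlim x).2
  choose a ha using hmem
  have hagree : ∀ x y n, (∀ k < n, x k = y k) → s x n = s y n := by
    intro x y n
    induction n with
    | zero => intro _; rfl
    | succ n ih =>
      intro h
      rw [hs1, hs1, ih fun k hk => h k (hk.trans (Nat.lt_succ_self n)), h n (Nat.lt_succ_self n)]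
  have hinj : Function.Injective fun x => (⟨_, ha x⟩ : Φ) := by
    intro x y hxy
    by_contra hne
    have hex : ∃ n, x n ≠ y n := Function.ne_iff.1 hne
    classical
    have hn := Nat.find_spec hex
    have hlt : ∀ k < Nat.find hex, x k = y k := fun k hk => not_not.1 (Nat.find_min hex hk)
    set n := Nat.find hex
    have heq : (⨅ n, (s x n).1) = ⨅ n, (s y n).1 :=
      congrArg (fun z : Φ => z.1.1) hxy
    have hx : (⨅ n, (s x n).1) ≤ S (s x n) (x n) := (iInf_le _ (n + 1)).trans (hs1 x n ▸ le_rfl)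
    have hy : (⨅ n, (s x n).1) ≤ S (s x n) (y n) := by
      rw [heq, hagree x y n hlt]
      exact (iInf_le _ (n + 1)).trans (hs1 y n ▸ le_rfl)
    have hd : Disjoint (S (s x n) (x n) : Filter ℕ) (S (s x n) (y n)) := by
      cases hxn : x n <;> cases hyn : y n
      · exact absurd (hxn.trans hyn.symm) hn
      · exact (hSd _).symm
      · exact hSd _
      · exact absurd (hxn.trans hyn.symm) hn
    exact (hlim x).2.neBot.ne (disjoint_self.1 (hd.mono hx hy))
  have := Cardinal.mk_le_of_injective hinj
  rw [show Cardinal.mk (ℕ → Bool) = Cardinal.continuum by simp] at this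
  exact absurd hcard (not_lt.2 this)

end Tree

/-! ### The coloured family of true cardinality 𝔠 -/

theorem colourClass_inter_infinite {a : Set ℕ} {i j : ℕ}
    (h : (a ∩ colourClass i ∩ colourClass j).Infinite) : i = j := by
  obtain ⟨x, hx⟩ := h.nonempty
  exact (show (Nat.unpair x).1 = i from hx.1.2).symm.trans hx.2

theorem exists_one_coloured_subset {a : Set ℕ} (ha : a.Infinite) :
    ∃ b ⊆ a, b.Infinite ∧
      ∀ i j, (b ∩ colourClass i).Infinite → (b ∩ colourClass j).Infinite → i = j := by
  by_cases h : ∃ i, (a ∩ colourClass i).Infinite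
  · obtain ⟨i, hi⟩ := h
    exact ⟨_, inter_subset_left, hi, fun j k hj hk =>
      (colourClass_inter_infinite hj).symm.trans (colourClass_inter_infinite hk)⟩
  · exact ⟨a, subset_rfl, ha, fun i _ hi _ => absurd ⟨i, hi⟩ h⟩

/-- There is an almost disjoint family of true cardinality `𝔠` each of whose members has an infinite
intersection with at most one colour class, while every colour class has an infinite intersection
with infinitely many members. -/
theorem exists_coloured_family : ∃ 𝒜 : Set (Set ℕ), IsAlmostDisjointFamily 𝒜 ∧
    HasTrueCardinalityContinuum 𝒜 ∧
    (∀ a ∈ 𝒜, ∀ i j, (a ∩ colourClass i).Infinite → (a ∩ colourClass j).Infinite → i = j) ∧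
    ∀ i, (familyRestrict 𝒜 (colourClass i)).Infinite := by
  obtain ⟨J, _, _, hJ, hIio, hbd⟩ := exists_wellOrder_continuum
  -- Bookkeeping in which every subset of ω is treated at 𝔠 many stages.
  obtain ⟨e⟩ : Nonempty (J ≃ J × Set ℕ) := by
    rw [← Cardinal.eq]
    simp [hJ]
  obtain ⟨f, hf⟩ := exists_recursive_choice (J := J) (α := Set (Filter ℕ × Set ℕ))
    (fun i g x => x.Subsingleton ∧
      (∀ F a, (F, a) ∈ x → IsNode (⋃ j, ⋃ hj : j < i, g j hj) F ∧
        (∀ b, (F, b) ∉ ⋃ j, ⋃ hj : j < i, g j hj) ∧ a.Infinite ∧ ConvergesTo a F ∧ a ⊆ (e i).2 ∧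
        ∀ k l, (a ∩ colourClass k).Infinite → (a ∩ colourClass l).Infinite → k = l) ∧
      (IsSystem (⋃ j, ⋃ hj : j < i, g j hj) →
        Cardinal.mk (⋃ j, ⋃ hj : j < i, g j hj : Set _) < Cardinal.continuum →
        (∃ F, IsNode (⋃ j, ⋃ hj : j < i, g j hj) F ∧ IsPositive F (e i).2) → x.Nonempty)) (by
    intro i g
    generalize (⋃ j, ⋃ hj : j < i, g j hj) = Φ
    by_cases h : IsSystem Φ ∧ Cardinal.mk Φ < Cardinal.continuum ∧
      ∃ F, IsNode Φ F ∧ IsPositive F (e i).2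
    · obtain ⟨hΦ, hcard, F, hF, hB⟩ := h
      obtain ⟨G, hG, hGB, hnot⟩ := hΦ.exists_unused_node hcard hF hB
      obtain ⟨a, haB, hainf, haG⟩ := exists_infinite_converging (hΦ.node_props hG).1 hGB
      obtain ⟨b, hba, hbinf, hb⟩ := exists_one_coloured_subset hainf
      refine ⟨{(G, b)}, subsingleton_singleton, ?_, fun _ _ _ => ⟨_, rfl⟩⟩
      rintro _ _ ⟨rfl, rfl⟩
      exact ⟨hG, hnot, hbinf, haG.subset hba, hba.trans haB, hb⟩
    · exact ⟨∅, subsingleton_empty, fun _ _ h => h.elim, fun h1 h2 h3 => absurd ⟨h1, h2, h3⟩ h⟩)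
  let Φ : Set J → Set (Filter ℕ × Set ℕ) := fun S => ⋃ j ∈ S, f j
  have hsub : ∀ i, (f i).Subsingleton := fun i => (hf i).1
  have hprop : ∀ i F a, (F, a) ∈ f i → IsNode (Φ (Iio i)) F ∧ (∀ b, (F, b) ∉ Φ (Iio i)) ∧
      a.Infinite ∧ ConvergesTo a F ∧ a ⊆ (e i).2 ∧
      ∀ k l, (a ∩ colourClass k).Infinite → (a ∩ colourClass l).Infinite → k = l :=
    fun i => (hf i).2.1
  have hne : ∀ i, IsSystem (Φ (Iio i)) → Cardinal.mk (Φ (Iio i)) < Cardinal.continuum →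
      (∃ F, IsNode (Φ (Iio i)) F ∧ IsPositive F (e i).2) → (f i).Nonempty := fun i => (hf i).2.2
  clear hf
  have hmemΦ : ∀ {S : Set J} {i : J} {z}, i ∈ S → z ∈ f i → z ∈ Φ S := fun hi hz =>
    mem_biUnion hi hz
  have hindex : ∀ i j F a b, (F, a) ∈ f i → (F, b) ∈ f j → i = j := by
    intro i j F a b hi hj
    rcases lt_trichotomy i j with h | h | h
    · exact absurd (hmemΦ (S := Iio j) h hi) ((hprop j F b hj).2.1 a)
    · exact h
    · exact absurd (hmemΦ (S := Iio i) h hj) ((hprop i F a hi).2.1 b)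
  have hsys : ∀ S, IsLowerSet S → IsSystem (Φ S) := by
    intro S hS
    have hex : ∀ {z}, z ∈ Φ S → ∃ i ∈ S, z ∈ f i := fun hz => by simpa [Φ] using hz
    refine ⟨?_, ?_, ?_, ?_⟩
    · intro F a b ha hb
      obtain ⟨i, -, hi⟩ := hex ha
      obtain ⟨j, -, hj⟩ := hex hb
      obtain rfl := hindex i j F a b hi hj
      exact congrArg Prod.snd (hsub i hi hj)
    · intro F a ha
      obtain ⟨i, hiS, hi⟩ := hex ha
      exact (hprop i F a hi).1.mono (biUnion_subset_biUnion_left fun j hj => hS (le_of_lt hj) hiS)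
    · intro F a ha
      obtain ⟨i, -, hi⟩ := hex ha
      exact (hprop i F a hi).2.2.1
    · intro F a ha
      obtain ⟨i, -, hi⟩ := hex ha
      exact (hprop i F a hi).2.2.2.1
  have hcard : ∀ i, Cardinal.mk (Φ (Iio i)) < Cardinal.continuum := by
    intro i
    have hex : ∀ z : Φ (Iio i), ∃ j : Iio i, (z : Filter ℕ × Set ℕ) ∈ f j := by
      rintro ⟨z, hz⟩
      obtain ⟨j, hj, hz⟩ := mem_iUnion₂.1 hz
      exact ⟨⟨j, hj⟩, hz⟩
    choose u hu using hex
    refine (Cardinal.mk_le_of_injective (f := u) fun y z hyz => ?_).trans_lt (hIio i)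
    exact Subtype.ext (hsub _ (hu y) (hyz ▸ hu z))
  have hall := hsys univ isLowerSet_univ
  let 𝒜 : Set (Set ℕ) := {a | ∃ F i, (F, a) ∈ f i}
  have hfin : ∀ {i j F G a b}, (F, a) ∈ f i → (G, b) ∈ f j → F ≠ G → (a ∩ b).Finite :=
    fun ha hb hFG => hall.finite_inter (hmemΦ (mem_univ _) ha) (hmemΦ (mem_univ _) hb) hFG
  have hfun : ∀ {i j F a b}, (F, a) ∈ f i → (F, b) ∈ f j → a = b :=
    fun ha hb => hall.functional _ _ _ (hmemΦ (mem_univ _) ha) (hmemΦ (mem_univ _) hb)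
  have hfull : ∀ (B : Set ℕ) (i₀ : J), (∀ i ≥ i₀, ∃ F, IsNode (Φ (Iio i)) F ∧ IsPositive F B) →
      Cardinal.mk (familyRestrict 𝒜 B) = Cardinal.continuum := by
    intro B i₀ hpos
    apply le_antisymm
    · refine (Cardinal.mk_set_le _).trans ?_
      simp
    -- The stages treating B, apart from those in a proper initial segment. There are still 𝔠 of
    -- them, and each contributes a new member contained in B.
    let T : Set J := {i | (e i).2 = B ∧ i₀ ≤ i}
    have hTex : ∀ i : T, ∃ z : Filter ℕ × Set ℕ, z ∈ f i := by
      rintro ⟨i, hi, hle⟩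
      refine hne i (hsys _ (isLowerSet_Iio i)) (hcard i) ?_
      rw [hi]
      exact hpos i hle
    choose z hz using hTex
    have hT : Cardinal.mk T ≤ Cardinal.mk (familyRestrict 𝒜 B) := by
      refine Cardinal.mk_le_of_injective (f := fun i : T => ⟨(z i).2, ⟨(z i).1, i, hz i⟩, ?_⟩) ?_
      · obtain ⟨-, -, hinf, -, hsubB, -⟩ := hprop i _ _ (hz i)
        rw [i.2.1] at hsubB
        rwa [inter_eq_left.2 hsubB]
      · intro i j hij
        have h2 : (z i).2 = (z j).2 := congrArg Subtype.val hij
        have h1 : (z i).1 = (z j).1 := by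
          by_contra hcon
          have := hfin (hz i) (hz j) hcon
          rw [h2, inter_self] at this
          exact (hprop j _ _ (hz j)).2.2.1 this
        refine Subtype.ext (hindex _ _ (z i).1 (z i).2 (z j).2 (hz i) ?_)
        rw [h1]; exact hz j
    refine le_trans ?_ hT
    by_contra! hlt
    have hcov : Cardinal.continuum ≤ Cardinal.mk (T ∪ Iio i₀ : Set J) := by
      rw [← hJ]
      refine Cardinal.mk_le_of_injective (f := fun j => ⟨e.symm (j, B), ?_⟩) ?_
      · rcases le_or_gt i₀ (e.symm (j, B)) with h | h
        · exact Or.inl ⟨by simp, h⟩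
        · exact Or.inr h
      · intro j k hjk
        simpa using hjk
    exact absurd (hcov.trans (Cardinal.mk_union_le _ _))
      (not_le.2 (Cardinal.add_lt_of_lt Cardinal.aleph0_le_continuum hlt (hIio i₀)))
  have hcolour : ∀ i, (familyRestrict 𝒜 (colourClass i)).Infinite := by
    intro i
    obtain ⟨i₀⟩ : Nonempty J := by
      rw [← Cardinal.mk_ne_zero_iff, hJ]
      exact Cardinal.continuum_ne_zero
    have := hfull (colourClass i) i₀ fun _ _ => ⟨_, .root, baseGrid_positive i⟩
    rw [← infinite_coe_iff, ← Cardinal.aleph0_le_mk_iff, this]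
    exact Cardinal.aleph0_le_continuum
  refine ⟨𝒜, ⟨(hcolour 0).mono fun a ha => ha.1, ?_, ?_⟩, ?_, ?_, hcolour⟩
  · rintro a ⟨F, i, hi⟩
    exact (hprop i F a hi).2.2.1
  · rintro a ⟨F, i, hi⟩ b ⟨G, j, hj⟩ hab
    exact hfin hi hj fun hFG => hab (by subst hFG; exact hfun hi hj)
  · intro B
    by_cases hB : (familyRestrict 𝒜 B).Finite
    · exact Or.inl hB
    right
    let a : ℕ ↪ familyRestrict 𝒜 B := Set.Infinite.natEmbedding _ hB
    have hmem : ∀ k, ∃ F i, (F, (a k : Set ℕ)) ∈ f i := fun k => (a k).2.1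
    choose F i hi using hmem
    -- Countably many stages are bounded, so from `i₀` on the system already contains infinitely
    -- many members meeting B, hence a node for which B is positive.
    obtain ⟨i₀, hi₀⟩ := hbd i
    refine hfull B i₀ fun j hj => ?_
    refine (hsys _ (isLowerSet_Iio j)).exists_positive_node
      (fun k => hmemΦ ((hi₀ k).trans_le hj) (hi k)) ?_ (fun k => (a k).2.2)
    intro k l hkl
    refine a.injective (Subtype.ext (hfun (hi k) (?_ : (F k, _) ∈ f (i l))))
    rw [hkl]; exact hi l
  · rintro a ⟨F, i, hi⟩
    exact (hprop i F a hi).2.2.2.2.2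

/-! ### Merging members into blocks -/

/-- A family of true cardinality `𝔠` can be partitioned into blocks of at most `n` members in such a
way that whenever at most `n` sets are each met by infinitely many members, some block meets them
all. -/
theorem exists_blocks {𝒜 : Set (Set ℕ)} (h𝒜 : HasTrueCardinalityContinuum 𝒜) {n : ℕ} (hn : 0 < n) :
    ∃ 𝒬 : Set (Finset (Set ℕ)), (∀ p ∈ 𝒬, ↑p ⊆ 𝒜 ∧ p.Nonempty ∧ p.card ≤ n) ∧
      (∀ p ∈ 𝒬, ∀ q ∈ 𝒬, p ≠ q → Disjoint p q) ∧ (∀ a ∈ 𝒜, ∃ p ∈ 𝒬, a ∈ p) ∧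
      ∀ 𝒯 : Finset (Set ℕ), 𝒯.Nonempty → 𝒯.card ≤ n →
        (∀ t ∈ 𝒯, (familyRestrict 𝒜 t).Infinite) →
        ∃ p ∈ 𝒬, ∀ t ∈ 𝒯, ∃ a ∈ p, (a ∩ t).Infinite := by
  classical
  obtain ⟨J, _, _, hJ, hIio, -⟩ := exists_wellOrder_continuum
  obtain ⟨e⟩ : Nonempty (J ≃ Finset (Set ℕ)) := by
    rw [← Cardinal.eq]
    simp [hJ]
  obtain ⟨f, hf⟩ := exists_recursive_choice (J := J) (α := Finset (Set ℕ))
    (fun i g x => (↑x ⊆ 𝒜 ∧ x.card ≤ n ∧ ∀ j hj, Disjoint (g j hj) x) ∧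
      ((e i).card ≤ n → (∀ t ∈ e i, (familyRestrict 𝒜 t).Infinite) →
        ∀ t ∈ e i, ∃ a ∈ x, (a ∩ t).Infinite)) (by
    intro i g
    by_cases h : (e i).card ≤ n ∧ ∀ t ∈ e i, (familyRestrict 𝒜 t).Infinite
    -- Members used so far: fewer than 𝔠 finite blocks, so each set in the current tuple is still
    -- met by an unused member.
    · let U : Set (Set ℕ) := ⋃ j : Iio i, ↑(g j j.2)
      have hU : Cardinal.mk U < Cardinal.continuum := by
        refine (Cardinal.mk_iUnion_le_sum_mk.trans (Cardinal.sum_le_sum _ (fun _ => Cardinal.aleph0)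
          fun j => ?_)).trans_lt ?_
        · exact (Cardinal.lt_aleph0_of_finite _).le
        · rw [Cardinal.sum_const']
          exact Cardinal.mul_lt_of_lt Cardinal.aleph0_le_continuum (hIio i)
            Cardinal.aleph0_lt_continuum
      have hsel : ∀ t ∈ e i, ∃ a ∈ familyRestrict 𝒜 t, a ∉ U := by
        intro t ht
        by_contra! hcon
        have hle := Cardinal.mk_le_mk_of_subset hcon
        rw [(h𝒜 t).resolve_left (h.2 t ht)] at hle
        exact absurd hU (not_lt.2 hle)
      choose! a ha haU using hsel
      refine ⟨(e i).image a, ⟨?_, Finset.card_image_le.trans h.1, ?_⟩, ?_⟩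
      · intro b hb
        obtain ⟨t, ht, rfl⟩ := Finset.mem_image.1 (Finset.mem_coe.1 hb)
        exact (ha t ht).1
      · intro j hj
        rw [Finset.disjoint_left]
        intro b hbj hb
        obtain ⟨t, ht, rfl⟩ := Finset.mem_image.1 hb
        exact haU t ht (mem_iUnion.2 ⟨⟨j, hj⟩, hbj⟩)
      · intro _ _ t ht
        exact ⟨a t, Finset.mem_image_of_mem a ht, (ha t ht).2⟩
    · exact ⟨∅, by simp, fun h1 h2 => absurd ⟨h1, h2⟩ h⟩)
  have hdisj : ∀ i j, i ≠ j → Disjoint (f i) (f j) := by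
    intro i j hij
    rcases lt_or_gt_of_ne hij with h | h
    · exact (hf j).1.2.2 i h
    · exact ((hf i).1.2.2 j h).symm
  -- Members never chosen become singleton blocks, so that the blocks cover 𝒜.
  refine ⟨{p | p.Nonempty ∧ ∃ i, f i = p} ∪ {p | ∃ a ∈ 𝒜, (∀ i, a ∉ f i) ∧ p = {a}},
    ?_, ?_, ?_, ?_⟩
  · rintro p (⟨hp, i, rfl⟩ | ⟨a, ha, -, rfl⟩)
    · exact ⟨(hf i).1.1, hp, (hf i).1.2.1⟩
    · exact ⟨by simpa using ha, Finset.singleton_nonempty a, by rw [Finset.card_singleton]; exact hn⟩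
  · rintro p (⟨-, i, rfl⟩ | ⟨a, -, hai, rfl⟩) q (⟨-, j, rfl⟩ | ⟨b, -, hbj, rfl⟩) hpq
    · exact hdisj i j fun h => hpq (by rw [h])
    · exact Finset.disjoint_singleton_right.2 (hbj i)
    · exact Finset.disjoint_singleton_left.2 (hai j)
    · exact Finset.disjoint_singleton.2 fun h => hpq (by rw [h])
  · intro a ha
    by_cases h : ∃ i, a ∈ f i
    · obtain ⟨i, hi⟩ := h
      exact ⟨f i, Or.inl ⟨⟨a, hi⟩, i, rfl⟩, hi⟩
    · exact ⟨{a}, Or.inr ⟨a, ha, not_exists.1 h, rfl⟩, Finset.mem_singleton_self a⟩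
  · intro 𝒯 hne hcard hinf
    have h := (hf (e.symm 𝒯)).2
    rw [Equiv.apply_symm_apply] at h
    have hp := h hcard hinf
    obtain ⟨t, ht⟩ := hne
    obtain ⟨a, ha, -⟩ := hp t ht
    exact ⟨_, Or.inl ⟨⟨a, ha⟩, _, rfl⟩, hp⟩

theorem infinite_sUnion_inter_iff (p : Finset (Set ℕ)) (B : Set ℕ) :
    (⋃₀ (p : Set (Set ℕ)) ∩ B).Infinite ↔ ∃ a ∈ p, (a ∩ B).Infinite := by
  rw [sUnion_eq_biUnion, iUnion₂_inter]
  constructor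
  · intro h
    by_contra! hcon
    exact h (p.finite_toSet.biUnion fun a ha => hcon a ha)
  · rintro ⟨a, ha, hinf⟩
    exact hinf.mono (subset_biUnion_of_mem (u := fun a => a ∩ B) (Finset.mem_coe.2 ha))

/-- An almost disjoint family of true cardinality `𝔠` which is rich with respect to `n` sets, but
each of whose members is almost disjoint from one of `n + 1` colour classes. -/
theorem exists_rich_family {n : ℕ} (hn : 0 < n) : ∃ ℳ : Set (Set ℕ), IsAlmostDisjointFamily ℳ ∧
    HasTrueCardinalityContinuum ℳ ∧
    (∀ 𝒯 : Finset (Set ℕ), 𝒯.Nonempty → 𝒯.card ≤ n → (∀ t ∈ 𝒯, (familyRestrict ℳ t).Infinite) →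
      ∃ m ∈ ℳ, ∀ t ∈ 𝒯, (m ∩ t).Infinite) ∧
    (∀ m ∈ ℳ, ∃ i ≤ n, (m ∩ colourClass i).Finite) ∧
    ∀ i, (familyRestrict ℳ (colourClass i)).Infinite := by
  obtain ⟨𝒜, hAD, hTC, hone, hcol⟩ := exists_coloured_family
  obtain ⟨𝒬, h𝒬, hdisj, hcov, hrich⟩ := exists_blocks hTC hn
  let ℳ : Set (Set ℕ) := {m | ∃ p ∈ 𝒬, m = ⋃₀ (p : Set (Set ℕ))}
  have hinf : ∀ p ∈ 𝒬, (⋃₀ (p : Set (Set ℕ))).Infinite := by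
    intro p hp
    obtain ⟨hsub, ⟨a, ha⟩, -⟩ := h𝒬 p hp
    exact (hAD.infinite_of_mem a (hsub ha)).mono (subset_sUnion_of_mem (Finset.mem_coe.2 ha))
  have hfin : ∀ p ∈ 𝒬, ∀ q ∈ 𝒬, p ≠ q →
      (⋃₀ (p : Set (Set ℕ)) ∩ ⋃₀ (q : Set (Set ℕ))).Finite := by
    intro p hp q hq hpq
    by_contra hcon
    obtain ⟨a, ha, hcon⟩ := (infinite_sUnion_inter_iff p _).1 hcon
    rw [inter_comm] at hcon
    obtain ⟨b, hb, hcon⟩ := (infinite_sUnion_inter_iff q _).1 hcon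
    refine hcon (hAD.finite_inter b ((h𝒬 q hq).1 hb) a ((h𝒬 p hp).1 ha) ?_)
    rintro rfl
    exact Finset.disjoint_left.1 (hdisj p hp q hq hpq) ha hb
  have hinj : ∀ p ∈ 𝒬, ∀ q ∈ 𝒬, ⋃₀ (p : Set (Set ℕ)) = ⋃₀ (q : Set (Set ℕ)) → p = q := by
    intro p hp q hq heq
    by_contra hne
    have := hfin p hp q hq hne
    rw [heq, inter_self] at this
    exact hinf q hq this
  choose! β hβ hβmem using hcov
  have hrestrict : ∀ B, familyRestrict ℳ B =
      (fun a => ⋃₀ (β a : Set (Set ℕ))) '' familyRestrict 𝒜 B := by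
    intro B
    ext m
    constructor
    · rintro ⟨⟨p, hp, rfl⟩, hm⟩
      obtain ⟨a, ha, haB⟩ := (infinite_sUnion_inter_iff p B).1 hm
      have ha𝒜 := (h𝒬 p hp).1 ha
      refine ⟨a, ⟨ha𝒜, haB⟩, ?_⟩
      by_contra hne
      exact Finset.disjoint_left.1 (hdisj _ (hβ a ha𝒜) p hp fun h => hne (by simp only [h]))
        (hβmem a ha𝒜) ha
    · rintro ⟨a, ⟨ha, haB⟩, rfl⟩
      exact ⟨⟨_, hβ a ha, rfl⟩, (infinite_sUnion_inter_iff _ B).2 ⟨a, hβmem a ha, haB⟩⟩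
  have hfull : ∀ B, (familyRestrict 𝒜 B).Infinite →
      Cardinal.mk (familyRestrict ℳ B) = Cardinal.continuum := by
    intro B hB
    have hc := (hTC B).resolve_left hB
    apply le_antisymm
    · refine (Cardinal.mk_set_le _).trans ?_
      simp
    by_contra! hlt
    have hblock : ∀ m : familyRestrict ℳ B, ∃ p ∈ 𝒬, (m : Set ℕ) = ⋃₀ (p : Set (Set ℕ)) :=
      fun m => m.2.1
    choose π hπ hπeq using hblock
    -- Fewer than 𝔠 finite blocks cannot cover the 𝔠 members of 𝒜 that meet B.
    have hsub : familyRestrict 𝒜 B ⊆ ⋃ m : familyRestrict ℳ B, (π m : Set (Set ℕ)) := by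
      intro a ha
      have hm : ⋃₀ (β a : Set (Set ℕ)) ∈ familyRestrict ℳ B := by
        rw [hrestrict]
        exact ⟨a, ha, rfl⟩
      refine mem_iUnion.2 ⟨⟨_, hm⟩, ?_⟩
      rw [← hinj _ (hβ a ha.1) _ (hπ ⟨_, hm⟩) (hπeq ⟨_, hm⟩)]
      exact hβmem a ha.1
    have hle := Cardinal.mk_le_mk_of_subset hsub
    rw [hc] at hle
    refine absurd (hle.trans (Cardinal.mk_iUnion_le_sum_mk.trans
      (Cardinal.sum_le_sum _ (fun _ => Cardinal.aleph0) fun m =>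
        (Cardinal.lt_aleph0_of_finite _).le))) (not_le.2 ?_)
    rw [Cardinal.sum_const']
    exact Cardinal.mul_lt_of_lt Cardinal.aleph0_le_continuum hlt Cardinal.aleph0_lt_continuum
  have hcolour : ∀ i, (familyRestrict ℳ (colourClass i)).Infinite := by
    intro i
    rw [← infinite_coe_iff, ← Cardinal.aleph0_le_mk_iff, hfull _ (hcol i)]
    exact Cardinal.aleph0_le_continuum
  have hfinite : ∀ B, (familyRestrict ℳ B).Infinite → (familyRestrict 𝒜 B).Infinite := by
    intro B hB hcon
    exact hB (by rw [hrestrict]; exact hcon.image _)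
  refine ⟨ℳ, ⟨(hcolour 0).mono fun a ha => ha.1, ?_, ?_⟩, ?_, ?_, ?_, hcolour⟩
  · rintro _ ⟨p, hp, rfl⟩
    exact hinf p hp
  · rintro _ ⟨p, hp, rfl⟩ _ ⟨q, hq, rfl⟩ hne
    exact hfin p hp q hq fun h => hne (by rw [h])
  · intro B
    by_cases hB : (familyRestrict ℳ B).Finite
    · exact Or.inl hB
    · exact Or.inr (hfull B (hfinite B hB))
  · intro 𝒯 hne hcard hT
    obtain ⟨p, hp, hpT⟩ := hrich 𝒯 hne hcard fun t ht => hfinite t (hT t ht)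
    exact ⟨_, ⟨p, hp, rfl⟩, fun t ht => (infinite_sUnion_inter_iff p t).2 (hpT t ht)⟩
  · rintro _ ⟨p, hp, rfl⟩
    by_contra! hcon
    have hsel : ∀ i : Fin (n + 1), ∃ a ∈ p, (a ∩ colourClass i).Infinite := fun i =>
      (infinite_sUnion_inter_iff p _).1 (hcon i (Nat.lt_succ_iff.1 i.2))
    choose a ha hai using hsel
    -- Each member carries at most one colour, so a block meeting n + 1 colours infinitely would
    -- need n + 1 members.
    have hle := Fintype.card_le_of_injective (fun i => (⟨a i, ha i⟩ : p)) fun i j hij => by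
      have hij' : a i = a j := congrArg Subtype.val hij
      exact Fin.ext (hone _ ((h𝒬 p hp).1 (ha i)) i j (hai i) (hij' ▸ hai j))
    simp only [Fintype.card_fin, Fintype.card_coe] at hle
    exact absurd (h𝒬 p hp).2.2 (by omega)

/-! ### Partial normality of Ψ-spaces -/

namespace PsiSpace

variable {ℳ : Set (Set ℕ)}

theorem isOpen_iff {U : Set (PsiSpace ℳ)} : IsOpen U ↔ ∀ a : ℳ, mem a ∈ U →
    ∃ F : Set ℕ, F.Finite ∧ ∀ k ∈ (a : Set ℕ) \ F, nat k ∈ U := Iff.rfl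

/-- The trace on `ω` of a subset of `Ψ(ℳ)`. -/
def trace (X : Set (PsiSpace ℳ)) : Set ℕ := nat ⁻¹' X

theorem isOpen_iff_finite {U : Set (PsiSpace ℳ)} :
    IsOpen U ↔ ∀ a : ℳ, mem a ∈ U → ((a : Set ℕ) \ trace U).Finite := by
  rw [isOpen_iff]
  refine forall₂_congr fun a _ => ⟨?_, fun h => ⟨_, h, fun k hk => ?_⟩⟩
  · rintro ⟨F, hF, h⟩
    refine hF.subset fun k hk => ?_
    by_contra hkF
    exact hk.2 (h k ⟨hk.1, hkF⟩)
  · by_contra hcon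
    exact hk.2 ⟨hk.1, hcon⟩

theorem isClosed_iff {X : Set (PsiSpace ℳ)} :
    IsClosed X ↔ ∀ a : ℳ, mem a ∉ X → ((a : Set ℕ) ∩ trace X).Finite := by
  rw [← isOpen_compl_iff, isOpen_iff_finite]
  refine forall₂_congr fun a _ => ?_
  rw [show (a : Set ℕ) \ trace Xᶜ = (a : Set ℕ) ∩ trace X by ext k; simp [trace]]

theorem mem_closure_iff_of_isOpen {U : Set (PsiSpace ℳ)} (hℳ : ∀ a ∈ ℳ, a.Infinite)
    (hU : IsOpen U) (a : ℳ) : mem a ∈ closure U ↔ ((a : Set ℕ) ∩ trace U).Infinite := by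
  constructor
  · intro ha hfin
    have hV : IsOpen ({mem a} ∪ nat '' ((a : Set ℕ) \ trace U)) := by
      rw [isOpen_iff_finite]
      rintro b (hb | ⟨k, -, hk⟩)
      · obtain rfl : b = a := by simpa using hb
        refine hfin.subset fun k hk => ⟨hk.1, ?_⟩
        by_contra hcon
        exact hk.2 (Or.inr ⟨k, ⟨hk.1, hcon⟩, rfl⟩)
      · cases hk
    obtain ⟨x, hxV, hxU⟩ := mem_closure_iff.1 ha _ hV (Or.inl rfl)
    rcases hxV with rfl | ⟨k, hk, rfl⟩
    · refine hℳ a a.2 ((hfin.union (isOpen_iff_finite.1 hU a hxU)).subset fun k hk => ?_)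
      by_cases hkU : k ∈ trace U
      · exact Or.inl ⟨hk, hkU⟩
      · exact Or.inr ⟨hk, hkU⟩
    · exact hk.2 hxU
  · intro hinf
    by_contra hcon
    exact hinf ((isClosed_iff.1 isClosed_closure a hcon).subset fun k hk =>
      ⟨hk.1, subset_closure hk.2⟩)

theorem mem_iff_of_isRegularClosed (hℳ : ∀ a ∈ ℳ, a.Infinite) {X : Set (PsiSpace ℳ)}
    (hX : IsRegularClosed X) (a : ℳ) : mem a ∈ X ↔ ((a : Set ℕ) ∩ trace X).Infinite := by
  constructor
  · intro ha
    rw [hX] at ha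
    exact ((mem_closure_iff_of_isOpen hℳ isOpen_interior a).1 ha).mono fun k hk =>
      ⟨hk.1, interior_subset (s := X) hk.2⟩
  · intro hinf
    by_contra hcon
    have hcl : IsClosed X := by
      rw [hX]
      exact isClosed_closure
    exact hinf (isClosed_iff.1 hcl a hcon)

/-- The regularly closed set generated by `S ⊆ ω`. -/
def regularClosure (ℳ : Set (Set ℕ)) (S : Set ℕ) : Set (PsiSpace ℳ) := closure (nat '' S)

theorem isOpen_image_nat (S : Set ℕ) : IsOpen (nat '' S : Set (PsiSpace ℳ)) := by
  rw [isOpen_iff_finite]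
  rintro a ⟨k, -, hk⟩
  cases hk

theorem trace_image_nat (S : Set ℕ) : trace (nat '' S : Set (PsiSpace ℳ)) = S := by
  ext k
  simp [trace]

theorem isRegularClosed_regularClosure (S : Set ℕ) : IsRegularClosed (regularClosure ℳ S) := by
  apply Subset.antisymm
  · exact closure_mono (interior_maximal subset_closure (isOpen_image_nat S))
  · exact closure_minimal interior_subset isClosed_closure

theorem mem_regularClosure (hℳ : ∀ a ∈ ℳ, a.Infinite) (S : Set ℕ) (a : ℳ) :
    mem a ∈ regularClosure ℳ S ↔ ((a : Set ℕ) ∩ S).Infinite := by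
  rw [regularClosure, mem_closure_iff_of_isOpen hℳ (isOpen_image_nat S), trace_image_nat]

theorem nat_mem_regularClosure (S : Set ℕ) (k : ℕ) : nat k ∈ regularClosure ℳ S ↔ k ∈ S := by
  constructor
  · intro hk
    have hopen : IsOpen ({nat k} : Set (PsiSpace ℳ)) := by
      simpa using isOpen_image_nat (ℳ := ℳ) {k}
    obtain ⟨x, rfl, l, hl, hlk⟩ := mem_closure_iff.1 hk _ hopen rfl
    cases hlk
    exact hl
  · exact fun hk => subset_closure ⟨k, hk, rfl⟩

/-- Almost disjointness makes the basic neighbourhoods `{a} ∪ (a ∩ U)` closed as well as open. -/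
theorem t3Space (hℳ : ∀ a ∈ ℳ, ∀ b ∈ ℳ, a ≠ b → (a ∩ b).Finite) : T3Space (PsiSpace ℳ) := by
  have hT1 : T1Space (PsiSpace ℳ) := by
    refine ⟨fun x => isClosed_iff.2 fun a _ => ?_⟩
    cases x with
    | nat k => exact (finite_singleton k).subset fun l hl => by simpa [trace] using hl.2
    | mem b => exact finite_empty.subset fun l hl => by simpa [trace] using hl.2
  have hreg : RegularSpace (PsiSpace ℳ) := by
    refine .of_exists_mem_nhds_isClosed_subset fun x s hs => ?_
    obtain ⟨U, hUs, hU, hxU⟩ := mem_nhds_iff.1 hs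
    cases x with
    | nat k =>
      refine ⟨{nat k}, ?_, isClosed_singleton, by simpa using hUs hxU⟩
      exact (by simpa using isOpen_image_nat (ℳ := ℳ) {k} : IsOpen {nat k}).mem_nhds rfl
    | mem a =>
      have htr : trace ({mem a} ∪ nat '' ((a : Set ℕ) ∩ trace U)) = (a : Set ℕ) ∩ trace U := by
        ext k
        simp [trace]
      refine ⟨{mem a} ∪ nat '' ((a : Set ℕ) ∩ trace U), IsOpen.mem_nhds ?_ (Or.inl rfl), ?_, ?_⟩
      · rw [isOpen_iff_finite]
        rintro b (hb | ⟨k, -, hk⟩)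
        · obtain rfl : b = a := by simpa using hb
          rw [htr]
          exact (isOpen_iff_finite.1 hU b hxU).subset fun k hk => ⟨hk.1, fun h => hk.2 ⟨hk.1, h⟩⟩
        · cases hk
      · rw [isClosed_iff]
        intro b hb
        rw [htr]
        refine (hℳ b b.2 a a.2 fun hab => hb (Or.inl ?_)).subset fun k hk => ⟨hk.1, hk.2.1⟩
        rw [mem_singleton_iff, Subtype.ext hab]
      · rintro _ (rfl | ⟨k, hk, rfl⟩)
        · exact hUs hxU
        · exact hUs hk.2
  exact ⟨⟩

theorem separatedNhds_of_finite (hℳ : ∀ a ∈ ℳ, ∀ b ∈ ℳ, a ≠ b → (a ∩ b).Finite)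
    {X Y : Set (PsiSpace ℳ)} (hX : IsClosed X) (hY : IsClosed Y) (hXY : Disjoint X Y)
    (hfin : {a : ℳ | mem a ∈ X}.Finite) : SeparatedNhds X Y := by
  -- X is enlarged by its finitely many members, minus Y. Each member in Y meets this enlargement in
  -- a finite set, so Y together with the remaining points of ω is open.
  let S : Set ℕ := {k | k ∉ trace Y ∧ ∃ a : ℳ, mem a ∈ X ∧ k ∈ (a : Set ℕ)}
  have htr : trace (X ∪ nat '' S) = trace X ∪ S := by
    ext k
    simp [trace]
  refine ⟨X ∪ nat '' S, Y ∪ nat '' (trace (X ∪ nat '' S))ᶜ, ?_, ?_, subset_union_left,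
    subset_union_left, ?_⟩
  · rw [isOpen_iff_finite]
    rintro a (ha | ⟨k, -, hk⟩)
    · refine (isClosed_iff.1 hY a (disjoint_left.1 hXY ha)).subset fun k hk => ⟨hk.1, ?_⟩
      by_contra hcon
      exact hk.2 (Or.inr ⟨k, ⟨hcon, a, ha, hk.1⟩, rfl⟩)
    · cases hk
  · rw [isOpen_iff_finite]
    rintro b (hb | ⟨k, -, hk⟩)
    · have hbX : mem b ∉ X := disjoint_right.1 hXY hb
      refine ((isClosed_iff.1 hX b hbX).union (hfin.biUnion (t := fun a : ℳ => (b : Set ℕ) ∩ a)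
        fun a ha => hℳ b b.2 a a.2 fun hba => ?_)).subset fun k hk => ?_
      · rw [Subtype.ext hba] at hbX
        exact hbX ha
      · have hk2 : k ∈ trace X ∪ S := by
          rw [← htr]
          by_contra hcon
          exact hk.2 (Or.inr ⟨k, hcon, rfl⟩)
        rcases hk2 with h | ⟨-, a, ha, hka⟩
        · exact Or.inl ⟨hk.1, h⟩
        · exact Or.inr (mem_biUnion (show a ∈ {a : ℳ | mem a ∈ X} from ha) ⟨hk.1, hka⟩)
    · cases hk
  · rw [disjoint_left]
    rintro x hx (hxY | ⟨k, hk, rfl⟩)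
    · rcases hx with hxX | ⟨k, hk, rfl⟩
      · exact disjoint_left.1 hXY hxX hxY
      · exact hk.1 hxY
    · exact hk hx

theorem finite_of_familyRestrict (hℳ : ∀ a ∈ ℳ, a.Infinite) {X : Set (PsiSpace ℳ)}
    (hX : IsRegularClosed X) (hfin : (familyRestrict ℳ (trace X)).Finite) :
    {a : ℳ | mem a ∈ X}.Finite := by
  refine Set.Finite.of_finite_image (f := Subtype.val) (hfin.subset ?_) Subtype.val_injective.injOn
  rintro _ ⟨a, ha, rfl⟩
  exact ⟨a.2, (mem_iff_of_isRegularClosed hℳ hX a).1 ha⟩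

/-- If all of the at most n + 1 regularly closed sets had infinite restrictions, a member meeting
all their traces would be a common point. So one of them contains finitely many points of ℳ, and
then so does A or the intersection. -/
theorem isPartlyNormal {n : ℕ} (hℳ : IsAlmostDisjointFamily ℳ)
    (hrich : ∀ 𝒯 : Finset (Set ℕ), 𝒯.Nonempty → 𝒯.card ≤ n + 1 →
      (∀ t ∈ 𝒯, (familyRestrict ℳ t).Infinite) → ∃ m ∈ ℳ, ∀ t ∈ 𝒯, (m ∩ t).Infinite) :
    IsPartlyNormal n (PsiSpace ℳ) := by
  classical
  refine ⟨t3Space hℳ.finite_inter, ?_⟩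
  rintro A _ hA ⟨K, hK, hKreg, rfl⟩ hdisj
  have hcl : ∀ {C : Set (PsiSpace ℳ)}, IsRegularClosed C → IsClosed C := by
    intro C hC
    rw [hC]
    exact isClosed_closure
  have hKcl : IsClosed (⋂ C ∈ K, C) := isClosed_biInter fun C hC => hcl (hKreg C hC)
  have hall : ∀ C ∈ insert A K, IsRegularClosed C := by
    intro C hC
    rcases Finset.mem_insert.1 hC with rfl | hC
    · exact hA
    · exact hKreg C hC
  by_cases hinf : ∀ C ∈ insert A K, (familyRestrict ℳ (trace C)).Infinite
  · exfalso
    obtain ⟨m, hm, hmt⟩ := hrich ((insert A K).image trace)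
      ((Finset.insert_nonempty A K).image trace)
      (Finset.card_image_le.trans ((Finset.card_insert_le A K).trans (by omega))) (by
        intro t ht
        obtain ⟨C, hC, rfl⟩ := Finset.mem_image.1 ht
        exact hinf C hC)
    have hmem : ∀ C ∈ insert A K, mem ⟨m, hm⟩ ∈ C := fun C hC =>
      (mem_iff_of_isRegularClosed hℳ.infinite_of_mem (hall C hC) ⟨m, hm⟩).2
        (hmt _ (Finset.mem_image_of_mem _ hC))
    exact disjoint_left.1 hdisj (hmem A (Finset.mem_insert_self A K))
      (mem_iInter₂.2 fun C hC => hmem C (Finset.mem_insert_of_mem hC))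
  · push Not at hinf
    obtain ⟨C, hC, hfin⟩ := hinf
    have hfinC := finite_of_familyRestrict hℳ.infinite_of_mem (hall C hC) hfin
    rcases Finset.mem_insert.1 hC with rfl | hCK
    · exact separatedNhds_of_finite hℳ.finite_inter (hcl hA) hKcl hdisj hfinC
    · exact (separatedNhds_of_finite hℳ.finite_inter hKcl (hcl hA) hdisj.symm
        (hfinC.subset fun a ha => mem_iInter₂.1 ha C hCK)).symm

/-- `Ψ(ℳ)` is not `(n + 1)`-partly-normal if `ℳ` is rich for `n + 1 ≥ 2` sets, but each member of `ℳ`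
is almost disjoint from one of `n + 2` pairwise disjoint sets. -/
theorem not_isPartlyNormal {n : ℕ} (hn : 0 < n) (hℳ : IsAlmostDisjointFamily ℳ)
    (hrich : ∀ 𝒯 : Finset (Set ℕ), 𝒯.Nonempty → 𝒯.card ≤ n + 1 →
      (∀ t ∈ 𝒯, (familyRestrict ℳ t).Infinite) → ∃ m ∈ ℳ, ∀ t ∈ 𝒯, (m ∩ t).Infinite)
    {Q : ℕ → Set ℕ} (hQ : Pairwise fun i j => Disjoint (Q i) (Q j))
    (hmiss : ∀ m ∈ ℳ, ∃ i ≤ n + 1, (m ∩ Q i).Finite)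
    (hQinf : ∀ i, (familyRestrict ℳ (Q i)).Infinite) :
    ¬ IsPartlyNormal (n + 1) (PsiSpace ℳ) := by
  classical
  intro hnormal
  let K : Finset (Set (PsiSpace ℳ)) := (Finset.Icc 1 (n + 1)).image fun i => regularClosure ℳ (Q i)
  have hK : ∀ x, x ∈ ⋂ C ∈ K, C ↔ ∀ i, 1 ≤ i → i ≤ n + 1 → x ∈ regularClosure ℳ (Q i) := by
    intro x
    simp [K]
  have hmemK : ∀ a : ℳ, mem a ∈ ⋂ C ∈ K, C ↔
      ∀ i, 1 ≤ i → i ≤ n + 1 → ((a : Set ℕ) ∩ Q i).Infinite := by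
    intro a
    simp only [hK, mem_regularClosure hℳ.infinite_of_mem]
  obtain ⟨U, V, hU, hV, hAU, hBV, hUV⟩ := hnormal.separated (regularClosure ℳ (Q 0))
    (⋂ C ∈ K, C) (isRegularClosed_regularClosure _)
    ⟨K, Finset.card_image_le.trans (by simp), by
      intro C hC
      obtain ⟨i, -, rfl⟩ := Finset.mem_image.1 hC
      exact isRegularClosed_regularClosure _, rfl⟩ (by
      -- On ω, colours 0 and 1 are already disjoint; a point of ℳ is excluded by the colour that it
      -- almost misses.
      rw [disjoint_left]
      intro x hx0 hxK
      cases x with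
      | nat k =>
        have h1 := (hK _).1 hxK 1 le_rfl (by omega)
        rw [nat_mem_regularClosure] at hx0 h1
        exact disjoint_left.1 (hQ Nat.zero_ne_one) hx0 h1
      | mem a =>
        rw [mem_regularClosure hℳ.infinite_of_mem] at hx0
        rw [hmemK] at hxK
        obtain ⟨i, hi, hfin⟩ := hmiss a a.2
        rcases Nat.eq_zero_or_pos i with rfl | hpos
        · exact hx0 hfin
        · exact hxK i hpos hi hfin)
  -- V splits `Q 1`, and one of the two halves is met by infinitely many members. If it is the half
  -- outside V, richness gives a point of the intersection that is not almost contained in V; if it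
  -- is the half inside V, a point of the closure of `Q 0` that is not almost contained in U.
  by_cases hcase : (familyRestrict ℳ (Q 1 \ trace V)).Infinite
  · obtain ⟨m, hm, hmt⟩ := hrich (insert (Q 1 \ trace V) ((Finset.Icc 2 (n + 1)).image Q))
      (Finset.insert_nonempty _ _)
      ((Finset.card_insert_le _ _).trans (Nat.succ_le_succ (Finset.card_image_le.trans
        (by simp)))) (by
        intro t ht
        rcases Finset.mem_insert.1 ht with rfl | ht
        · exact hcase
        · obtain ⟨i, -, rfl⟩ := Finset.mem_image.1 ht
          exact hQinf i)
    have h1 := hmt _ (Finset.mem_insert_self _ _)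
    have hmB : mem ⟨m, hm⟩ ∈ ⋂ C ∈ K, C := by
      rw [hmemK]
      intro i hi1 hi2
      rcases hi1.eq_or_lt with rfl | hlt
      · exact h1.mono fun k hk => ⟨hk.1, hk.2.1⟩
      · exact hmt _ (Finset.mem_insert_of_mem (Finset.mem_image_of_mem Q
          (Finset.mem_Icc.2 ⟨hlt, hi2⟩)))
    exact h1 ((isOpen_iff_finite.1 hV _ (hBV hmB)).subset fun k hk => ⟨hk.1, hk.2.2⟩)
  · have hcase' : (familyRestrict ℳ (Q 1 ∩ trace V)).Infinite := by
      intro hfin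
      refine hQinf 1 (((not_infinite.1 hcase).union hfin).subset fun a ha => ?_)
      by_contra hcon
      simp only [mem_union, not_or] at hcon
      have h1 : (a ∩ (Q 1 \ trace V)).Finite := not_infinite.1 fun h => hcon.1 ⟨ha.1, h⟩
      have h2 : (a ∩ (Q 1 ∩ trace V)).Finite := not_infinite.1 fun h => hcon.2 ⟨ha.1, h⟩
      refine ha.2 ((h1.union h2).subset fun k hk => ?_)
      by_cases hkV : k ∈ trace V
      · exact Or.inr ⟨hk.1, hk.2, hkV⟩
      · exact Or.inl ⟨hk.1, hk.2, hkV⟩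
    obtain ⟨m, hm, hmt⟩ := hrich {Q 0, Q 1 ∩ trace V} (Finset.insert_nonempty _ _)
      (Finset.card_le_two.trans (by omega)) (by
        intro t ht
        rcases Finset.mem_insert.1 ht with rfl | ht
        · exact hQinf 0
        · rw [Finset.mem_singleton.1 ht]
          exact hcase')
    have hmA : mem ⟨m, hm⟩ ∈ regularClosure ℳ (Q 0) :=
      (mem_regularClosure hℳ.infinite_of_mem _ _).2 (hmt _ (by simp))
    refine hmt (Q 1 ∩ trace V) (by simp)
      ((isOpen_iff_finite.1 hU _ (hAU hmA)).subset fun k hk => ⟨hk.1, fun hkU => ?_⟩)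
    exact disjoint_left.1 hUV hkU hk.2.2

end PsiSpace

theorem pairwise_disjoint_colourClass :
    Pairwise fun i j => Disjoint (colourClass i) (colourClass j) := by
  intro i j hij
  rw [disjoint_left]
  intro x hi hj
  exact hij ((show (Nat.unpair x).1 = i from hi).symm.trans hj)

theorem theorem2p8 (n : ℕ) (hn : 0 < n) :
    ∃ 𝒜 : Set (Set ℕ), IsAlmostDisjointFamily 𝒜 ∧ HasTrueCardinalityContinuum 𝒜 ∧
      IsPartlyNormal n (PsiSpace 𝒜) ∧ ¬ IsPartlyNormal (n + 1) (PsiSpace 𝒜) := by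
  -- Richness is needed for n + 1 sets: A itself and the n sets whose intersection is B.
  obtain ⟨ℳ, hAD, hTC, hrich, hmiss, hcol⟩ := exists_rich_family n.succ_pos
  exact ⟨ℳ, hAD, hTC, PsiSpace.isPartlyNormal hAD hrich,
    PsiSpace.not_isPartlyNormal hn hAD hrich pairwise_disjoint_colourClass hmiss hcol⟩
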